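/- **Theorem 5.** *Network.* Let $n\ge 2$ agents communicate over an undirected connected graph with symmetric weighted adjacency matrix $A=[A_{ij}]$, $A_{ij}\ge 0$, and Laplacian $L=\mathrm{diag}(\sum_jA_{ij})-A$. Let $\rho$ be the spectral radius and $\rho_2$ the smallest positive eigenvalue of $L$. *Costs.* Let $f_1,\dots,f_n:\mathbb R^d\to\mathbb R$ be differentiable with $\|\nabla f_i(x)-\nabla f_i(y)\|\le \ell\|x-y\|$ for all $x,y$, where $\ell>0$, let $f=\frac1n\sum_i f_i$, assume $f^\ast=\inf f>-\infty$, and assume the Polyak–Łojasiewicz condition $\frac12\|\nabla f(x)\|^2\ge\nu(f(x)-f^\ast)$ for all $x$, with $\nu>0$. *Compressor.* Let $\mathcal C$ be a randomized map $\mathbb R^d\to\mathbb R^d$ with $\mathbb E_{\mathcal C}\big[\|\mathcal C(x)/r-x\|^2\big]\le(1-\delta)\|x\|^2+C$ for all $x\in\mathbb R^d$, where $r>0$, $C>0$, $\delta\in(0,1]$. Each use of $\mathcal C$ (by an agent at an iteration) draws internal randomness of the same law, independent of the randomness of all earlier iterations. *Algorithm.* Given $x_{i,0}\in\mathbb R^d$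 and $v_{i,0}=\hat x_{i,-1}=y_{i,-1}=0$, for $k=0,1,\dots$ and $i=1,\dots,n$ let $$q_{i,k}=\mathcal C\big((x_{i,k}-\hat x_{i,k-1})/s_k\big),\quad \hat x_{i,k}=\hat x_{i,k-1}+\omega s_kq_{i,k},\quad y_{i,k}=y_{i,k-1}+\omega s_k\sum_{j}L_{ij}q_{j,k},$$ $$x_{i,k+1}=x_{i,k}-\alpha\big(\beta y_{i,k}+\gamma v_{i,k}+\nabla f_i(x_{i,k})\big),\quad v_{i,k+1}=v_{i,k}+\alpha\gamma y_{i,k},$$ and let $\bar x_k=\frac1n\sum_ix_{i,k}$. *Constants.* Put $\varepsilon_9=\omega r\delta/2$, $\varepsilon_{10}=(1-2\varepsilon_9)(1+\varepsilon_9^{-1})$, $\varepsilon_{12}=(\varepsilon_9+2\varepsilon_9^2)/2$, $$\kappa_1=\tfrac4{\rho_2},\quad \kappa_2=\max\Big\{2+2\ell^2,\ \tfrac5{\rho_2},\ \sqrt[3]{\tfrac{16\ell^2(\kappa_1+1)^2}{\rho_2}},\ \tfrac{2\sqrt2\,\ell}{\rho_2}\Big\},\quad \varepsilon_2=\max\Big\{\tfrac{1+\tau_1\rho_2}2,\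 \tfrac{1+\tau_1}2+\tfrac1{2\tau_1\rho_2^2}\Big\},$$ $$\varphi_1=\tfrac12\big(\rho_2\beta-(3\gamma+2+2\ell^2)\big),\quad \varphi_2'=(3+4\varepsilon_{10})\rho^2\beta^2-\rho_2\beta\gamma+(\rho+2)\gamma^2+1+(\tfrac52+4\varepsilon_{10})\ell^2,$$ $$\varphi_3=\tfrac\gamma2-\tfrac5{2\rho_2},\quad \varphi_4'=(2+4\varepsilon_{10})\rho\gamma^2+\tfrac12\rho,\quad \varphi_5=\tfrac18-\tfrac{(\beta+\gamma)^2\ell^2}{\gamma^5\rho_2}-\tfrac{\ell^2}{2\gamma^2\rho_2^2},$$ $$\varphi_6=\tfrac{(\beta+\gamma)\ell^2}{2\gamma^3\rho_2}+\tfrac{\ell^2}{2\gamma^2\rho_2^2}+\tfrac{\ell^2}{2\rho_2^2}+\tfrac{\ell^2}2+\tfrac\ell2,\quad \varphi_7=(\rho+1)\gamma+\tfrac12\rho\beta,$$ $$\varphi_8'=(3+4\varepsilon_{10})\rho^2\beta^2+(\rho-2\rho_2)\beta\gamma+(\rho+2)\gamma^2+1,$$ $$\hat\kappa_0'=\min\Big\{\tfrac{\varphi_1}{\varphi_2'},\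 \tfrac{\varphi_3}{\varphi_4'},\ \tfrac{\varphi_5}{\varphi_6},\ \tfrac{\sqrt{\varphi_7^2+8\varepsilon_{12}\varphi_8'}-\varphi_7}{2\varphi_8'}\Big\},$$ $$\varepsilon_3'=\min\{\varphi_1-\alpha\varphi_2',\ \varphi_3-\alpha\varphi_4'\},\quad \varepsilon_6'=\tfrac1{\varepsilon_2}\min\Big\{\tfrac\nu2,\ \varepsilon_3',\ \tfrac{2\varepsilon_{12}-\alpha\varphi_7-\alpha^2\varphi_8'}\alpha\Big\}.$$ *Parameters.* Let $\tau_1\ge\kappa_1$, $\gamma>\kappa_2$, $\beta=\tau_1\gamma$, $\omega\in(0,1/r]$, $\alpha\in(0,\hat\kappa_0')$, $\varepsilon\in(0,1)$, $s_k=s_0\varepsilon^k$ with $s_0>0$ and $s_0\ge\max_i\|x_{i,0}\|_p$ for some $p\in[1,\infty]$. *Conclusion.* Then $\max\{1-\alpha\varepsilon_6',\varepsilon^2\}\in(0,1)$, the expectations below are finite, and for every $\hat\varepsilon\in(\max\{1-\alpha\varepsilon_6',\varepsilon^2\},1)$, $$\mathbb E_{\mathcal C}\Big[f(\bar x_k)-f^\ast+\frac1n\sum_{i=1}^n\|x_{i,k}-\bar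 x_k\|^2\Big]=\mathcal O(\hat\varepsilon^{\,k})\qquad(k\to\infty).$$ -/

import Mathlib

open MeasureTheory ProbabilityTheory Filter

noncomputable section

namespace UnifiedCompression

/-! ### Communication network -/

/-- The graph underlying a weighted adjacency matrix: `i ≠ j` are joined when the weight of
`(i, j)` or of `(j, i)` is positive. -/
def supportGraph {n : ℕ} (A : Matrix (Fin n) (Fin n) ℝ) : SimpleGraph (Fin n) :=
  SimpleGraph.fromRel (fun i j => 0 < A i j)

/-- `A` is the weighted adjacency matrix of an undirected connected graph. -/
structure IsUndirectedConnected {n : ℕ} (A : Matrix (Fin n) (Fin n) ℝ) : Prop where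
  nonneg : ∀ i j, 0 ≤ A i j
  symm : A.IsSymm
  connected : (supportGraph A).Connected

/-- The Laplacian `L = D - A`, where `D` is the diagonal matrix of the row sums of `A`. -/
def laplacian {n : ℕ} (A : Matrix (Fin n) (Fin n) ℝ) : Matrix (Fin n) (Fin n) ℝ :=
  Matrix.diagonal (fun i => ∑ j, A i j) - A

/-- Spectral radius of a real symmetric matrix, as a real number. -/
def rho {n : ℕ} (M : Matrix (Fin n) (Fin n) ℝ) : ℝ := (spectralRadius ℝ M).toReal

/-- Smallest positive eigenvalue of a real symmetric matrix. -/
def rho2 {n : ℕ} (M : Matrix (Fin n) (Fin n) ℝ) : ℝ := sInf {μ : ℝ | μ ∈ spectrum ℝ M ∧ 0 < μ}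

/-! ### Cost functions -/

/-- The global cost `f = (1/n) ∑ i, f_i`. -/
def globalCost {n d : ℕ} (f : Fin n → EuclideanSpace ℝ (Fin d) → ℝ)
    (x : EuclideanSpace ℝ (Fin d)) : ℝ :=
  (1 / (n : ℝ)) * ∑ i, f i x

/-- The optimal value `f* = inf f`, used only for `f` bounded below. -/
def optValue {n d : ℕ} (f : Fin n → EuclideanSpace ℝ (Fin d) → ℝ) : ℝ :=
  ⨅ x, globalCost f x

/-- `h` is differentiable with an `ℓ`-Lipschitz gradient. -/
def IsSmoothWith {d : ℕ} (ℓ : ℝ) (h : EuclideanSpace ℝ (Fin d) → ℝ) : Prop :=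
  Differentiable ℝ h ∧ ∀ x y, ‖gradient h x - gradient h y‖ ≤ ℓ * ‖x - y‖

/-- Polyak–Łojasiewicz condition with constant `ν` for the global cost. -/
def PLCondition {n d : ℕ} (ν : ℝ) (f : Fin n → EuclideanSpace ℝ (Fin d) → ℝ) : Prop :=
  ∀ x, ν * (globalCost f x - optValue f) ≤ (1 / 2) * ‖gradient (globalCost f) x‖ ^ 2

/-! ### Compressors -/

/-- A randomized compressor `𝒞(ζ, x)`, whose internal randomness `ζ` has law `P`, is globally
bounded with parameters `r`, `δ`, `C`:
`E ‖𝒞(x) / r - x‖² ≤ (1 - δ) ‖x‖² + C` for every `x`. -/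
structure GloballyBounded {d : ℕ} {Z : Type*} [MeasurableSpace Z] (P : Measure Z)
    (𝒞 : Z → EuclideanSpace ℝ (Fin d) → EuclideanSpace ℝ (Fin d)) (r δ C : ℝ) : Prop where
  measurable : Measurable (fun p : Z × EuclideanSpace ℝ (Fin d) => 𝒞 p.1 p.2)
  integrable : ∀ x, Integrable (fun z => ‖r⁻¹ • 𝒞 z x - x‖ ^ 2) P
  bound : ∀ x, ∫ z, ‖r⁻¹ • 𝒞 z x - x‖ ^ 2 ∂P ≤ (1 - δ) * ‖x‖ ^ 2 + C

/-- The internal randomness `ζ i k` of the compression by agent `i` at iteration `k` has law `P`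
and is independent of all the randomness of the iterations before `k`.  Nothing is required of
the joint law of the agents within one iteration. -/
structure IsCompressionNoise {n : ℕ} {Ω Z : Type*} [MeasurableSpace Ω] [MeasurableSpace Z]
    (μ : Measure Ω) (P : Measure Z) (ζ : Fin n → ℕ → Ω → Z) : Prop where
  law : ∀ i k, MeasurePreserving (ζ i k) μ P
  indep : ∀ i k, IndepFun (ζ i k) (fun a => fun (j : Fin n) (t : Fin k) => ζ j t a) μ

/-! ### The algorithm -/

/-- What the agents hold at the start of iteration `k`: `x_{i,k}`, `v_{i,k}`, the surrogate
`x̂_{i,k-1}` and the auxiliary variable `y_{i,k-1}`. -/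
structure State (n d : ℕ) where
  x : Fin n → EuclideanSpace ℝ (Fin d)
  v : Fin n → EuclideanSpace ℝ (Fin d)
  xhat : Fin n → EuclideanSpace ℝ (Fin d)
  y : Fin n → EuclideanSpace ℝ (Fin d)

/-- Initial state: `x_{i,0}` given and `v_{i,0} = x̂_{i,-1} = y_{i,-1} = 0`. -/
def State.init {n d : ℕ} (x0 : Fin n → EuclideanSpace ℝ (Fin d)) : State n d where
  x := x0
  v := fun _ => 0
  xhat := fun _ => 0
  y := fun _ => 0

/-- One iteration with scaling factor `s`, where `c i` is the realization of the compressor used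
by agent `i`. -/
def State.step {n d : ℕ} (f : Fin n → EuclideanSpace ℝ (Fin d) → ℝ)
    (L : Matrix (Fin n) (Fin n) ℝ) (α β γ ω s : ℝ)
    (c : Fin n → EuclideanSpace ℝ (Fin d) → EuclideanSpace ℝ (Fin d))
    (S : State n d) : State n d :=
  let q : Fin n → EuclideanSpace ℝ (Fin d) := fun i => c i (s⁻¹ • (S.x i - S.xhat i))
  let xhat' : Fin n → EuclideanSpace ℝ (Fin d) := fun i => S.xhat i + (ω * s) • q i
  let y' : Fin n → EuclideanSpace ℝ (Fin d) := fun i => S.y i + (ω * s) • ∑ j, L i j • q j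
  { x := fun i => S.x i - α • (β • y' i + γ • S.v i + gradient (f i) (S.x i))
    v := fun i => S.v i + (α * γ) • y' i
    xhat := xhat'
    y := y' }

/-- The state at the start of iteration `k` along the noise realization `z`, with scaling
factors `s`. -/
def run {n d : ℕ} {Z : Type*} (f : Fin n → EuclideanSpace ℝ (Fin d) → ℝ)
    (L : Matrix (Fin n) (Fin n) ℝ) (α β γ ω : ℝ) (s : ℕ → ℝ)
    (𝒞 : Z → EuclideanSpace ℝ (Fin d) → EuclideanSpace ℝ (Fin d))
    (x0 : Fin n → EuclideanSpace ℝ (Fin d)) (z : Fin n → ℕ → Z) : ℕ → State n d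
  | 0 => State.init x0
  | k + 1 => State.step f L α β γ ω (s k) (fun i => 𝒞 (z i k))
      (run f L α β γ ω s 𝒞 x0 z k)

/-- The average of the agents' vectors. -/
def average {n d : ℕ} (x : Fin n → EuclideanSpace ℝ (Fin d)) : EuclideanSpace ℝ (Fin d) :=
  (1 / (n : ℝ)) • ∑ i, x i

/-- Optimality gap at the average plus consensus error,
`f(x̄) - f* + (1/n) ∑ i, ‖x_i - x̄‖²`. -/
def performance {n d : ℕ} (f : Fin n → EuclideanSpace ℝ (Fin d) → ℝ)
    (x : Fin n → EuclideanSpace ℝ (Fin d)) : ℝ :=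
  globalCost f (average x) - optValue f + (1 / (n : ℝ)) * ∑ i, ‖x i - average x‖ ^ 2

/-! ### Constants

Here `ρ` and `ρ₂` stand for the spectral radius and the smallest positive eigenvalue of the
Laplacian. -/

def kappa1 (ρ₂ : ℝ) : ℝ := 4 / ρ₂

def kappa2 (ρ₂ ℓ : ℝ) : ℝ :=
  max (max (2 + 2 * ℓ ^ 2) (5 / ρ₂))
    (max ((16 * ℓ ^ 2 * (kappa1 ρ₂ + 1) ^ 2 / ρ₂) ^ (1 / 3 : ℝ)) (2 * √2 * ℓ / ρ₂))

def eps2 (ρ₂ τ₁ : ℝ) : ℝ :=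
  max ((1 + τ₁ * ρ₂) / 2) ((1 + τ₁) / 2 + 1 / (2 * τ₁ * ρ₂ ^ 2))

def eps9 (ω r δ : ℝ) : ℝ := ω * r * δ / 2

def eps10 (ω r δ : ℝ) : ℝ := (1 - 2 * eps9 ω r δ) * (1 + (eps9 ω r δ)⁻¹)

def eps12 (ω r δ : ℝ) : ℝ := (eps9 ω r δ + 2 * eps9 ω r δ ^ 2) / 2

def phi1 (ρ₂ ℓ β γ : ℝ) : ℝ := (1 / 2) * (ρ₂ * β - (3 * γ + 2 + 2 * ℓ ^ 2))

def phi2' (ρ ρ₂ ℓ β γ ω r δ : ℝ) : ℝ :=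
  (3 + 4 * eps10 ω r δ) * ρ ^ 2 * β ^ 2 - ρ₂ * β * γ + (ρ + 2) * γ ^ 2 + 1
    + (5 / 2 + 4 * eps10 ω r δ) * ℓ ^ 2

def phi3 (ρ₂ γ : ℝ) : ℝ := γ / 2 - (5 / 2) * ρ₂⁻¹

def phi4' (ρ γ ω r δ : ℝ) : ℝ := (2 + 4 * eps10 ω r δ) * ρ * γ ^ 2 + (1 / 2) * ρ

def phi5 (ρ₂ ℓ β γ : ℝ) : ℝ :=
  1 / 8 - (β + γ) ^ 2 / γ ^ 5 * ρ₂⁻¹ * ℓ ^ 2 - 1 / (2 * γ ^ 2) * (ρ₂⁻¹) ^ 2 * ℓ ^ 2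

def phi6 (ρ₂ ℓ β γ : ℝ) : ℝ :=
  (β + γ) / (2 * γ ^ 3) * ρ₂⁻¹ * ℓ ^ 2 + 1 / (2 * γ ^ 2) * (ρ₂⁻¹) ^ 2 * ℓ ^ 2
    + (ρ₂⁻¹) ^ 2 / 2 * ℓ ^ 2 + ℓ ^ 2 / 2 + ℓ / 2

def phi7 (ρ β γ : ℝ) : ℝ := (ρ + 1) * γ + (1 / 2) * ρ * β

def phi8' (ρ ρ₂ β γ ω r δ : ℝ) : ℝ :=
  (3 + 4 * eps10 ω r δ) * ρ ^ 2 * β ^ 2 + (ρ - 2 * ρ₂) * β * γ + (ρ + 2) * γ ^ 2 + 1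

/-- Upper bound for the stepsize `α`. -/
def kappa0' (ρ ρ₂ ℓ β γ ω r δ : ℝ) : ℝ :=
  min (min (phi1 ρ₂ ℓ β γ / phi2' ρ ρ₂ ℓ β γ ω r δ) (phi3 ρ₂ γ / phi4' ρ γ ω r δ))
    (min (phi5 ρ₂ ℓ β γ / phi6 ρ₂ ℓ β γ)
      ((√(phi7 ρ β γ ^ 2 + 8 * eps12 ω r δ * phi8' ρ ρ₂ β γ ω r δ) - phi7 ρ β γ)
        / (2 * phi8' ρ ρ₂ β γ ω r δ)))

def eps3' (ρ ρ₂ ℓ α β γ ω r δ : ℝ) : ℝ :=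
  min (phi1 ρ₂ ℓ β γ - α * phi2' ρ ρ₂ ℓ β γ ω r δ) (phi3 ρ₂ γ - α * phi4' ρ γ ω r δ)

/-- The constant that determines the linear rate `1 - α ε₆'`. -/
def eps6' (ρ ρ₂ ℓ ν α β γ τ₁ ω r δ : ℝ) : ℝ :=
  min (ν / 2) (min (eps3' ρ ρ₂ ℓ α β γ ω r δ)
    ((2 * eps12 ω r δ - α * phi7 ρ β γ - α ^ 2 * phi8' ρ ρ₂ β γ ω r δ) / α)) / eps2 ρ₂ τ₁

end UnifiedCompression

end

/-! Stack the agents' vectors and let `K` be the centering projection, `L` the Laplacian and `Q` its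
pseudo-inverse. Since `y = L x̂`, the method is a primal-dual iteration `x' = x - α(β L(x - e) + γ v
+ g)`, `v' = v + αγ L(x - e)`, perturbed by the compression error `e = x - x̂`. Both `L z` and `v`
have mean zero, so the average performs a gradient step with the averaged local gradients.

The Lyapunov function `lyapunov` adds to `n (f(x̄) - f*)` a quadratic form in `X = K x` and `W = K(v
+ γ⁻¹ ∇F(x̄))`, where `∇F(x̄)` stacks the local gradients at the average. Under the
Polyak–Łojasiewicz condition minimizers need not be unique, so the dual variable is compared with
its balancing value at the current average instead of at a minimizer. The price is a drift `D` of
that reference, of size `αℓ` times the norm of the averaged gradient; the descent lemma supplies a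
negative square to pay for it.

`lyap_step_eq` expands the quadratic form exactly; `first_order_le` and `second_order_le` estimate
the terms by Young's inequality. With `gap_step_le` they give the pathwise contraction
`lyapunov_step_le`: the new Lyapunov value plus `(1 - 2ε₉)‖x' - x̂‖²` is at most `1 - αε₆'` times
the old value plus `‖e‖²`. Averaging over the fresh noise (`lintegral_error_le`) bounds the next
mean squared error by the mean of `(1 - 2ε₉)‖x' - x̂‖²` plus a multiple of `s_k²`, exactly the
quantity already controlled.

The total `V_k` therefore satisfies `V_{k+1} ≤ q V_k + M q^{k+1}` with `q = max(1 - αε₆', ε²)`,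
hence `V_k ≤ B (k+1) q^k`, and every rate strictly above `q` absorbs the linear factor. Expectations
are lower integrals throughout, so integrability is a consequence of the final bound and not an
assumption of the recursion. -/

noncomputable section

namespace UnifiedCompression

/-! ### Matrices acting on stacked vectors -/

/-- The space of stacked vectors `(x_1, …, x_n)` with the Euclidean norm. -/
abbrev Stack (n d : ℕ) : Type := PiLp 2 (fun _ : Fin n => EuclideanSpace ℝ (Fin d))

/-- The action of the Kronecker product `M ⊗ I_d` on stacked vectors. -/
def act {n d : ℕ} (M : Matrix (Fin n) (Fin n) ℝ) : Stack n d →ₗ[ℝ] Stack n d where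
  toFun x := WithLp.toLp 2 (fun i => ∑ j, M i j • x j)
  map_add' x y := by
    ext1 i; simp [Finset.sum_add_distrib]
  map_smul' c x := by
    ext1 i; simp [Finset.smul_sum, smul_comm c]

@[simp] lemma act_apply {n d : ℕ} (M : Matrix (Fin n) (Fin n) ℝ) (x : Stack n d) (i : Fin n) :
    act M x i = ∑ j, M i j • x j := rfl

lemma act_mul {n d : ℕ} (M N : Matrix (Fin n) (Fin n) ℝ) (x : Stack n d) :
    act (M * N) x = act M (act N x) := by
  ext1 i
  simp only [act_apply, Matrix.mul_apply, Finset.sum_smul, Finset.smul_sum, smul_smul]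
  exact Finset.sum_comm

lemma act_one {n d : ℕ} (x : Stack n d) : act 1 x = x := by
  ext1 i
  simp [Matrix.one_apply]

lemma act_sub {n d : ℕ} (M N : Matrix (Fin n) (Fin n) ℝ) (x : Stack n d) :
    act (M - N) x = act M x - act N x := by
  ext1 i
  simp [sub_smul]

lemma act_smul {n d : ℕ} (c : ℝ) (M : Matrix (Fin n) (Fin n) ℝ) (x : Stack n d) :
    act (c • M) x = c • act M x := by
  ext1 i
  simp [Finset.smul_sum, smul_smul]

lemma inner_act {n d : ℕ} {M : Matrix (Fin n) (Fin n) ℝ} (hM : M.transpose = M)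
    (x y : Stack n d) : inner ℝ (act M x) y = inner ℝ x (act M y) := by
  have h1 : inner ℝ (act M x) y = ∑ i, ∑ j, M i j * inner ℝ (x j) (y i) := by
    rw [PiLp.inner_apply]
    exact Finset.sum_congr rfl fun i _ => by
      rw [act_apply, sum_inner]
      exact Finset.sum_congr rfl fun j _ => real_inner_smul_left _ _ _
  have h2 : inner ℝ x (act M y) = ∑ i, ∑ j, M i j * inner ℝ (x i) (y j) := by
    rw [PiLp.inner_apply]
    exact Finset.sum_congr rfl fun i _ => by
      rw [act_apply, inner_sum]
      exact Finset.sum_congr rfl fun j _ => real_inner_smul_right _ _ _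
  rw [h1, h2, Finset.sum_comm]
  refine Finset.sum_congr rfl fun i _ => Finset.sum_congr rfl fun j _ => ?_
  rw [show M j i = M i j from congrFun (congrFun hM i) j]

/-! ### Functional calculus of a symmetric matrix -/

section Spectral

variable {n : ℕ} {M : Matrix (Fin n) (Fin n) ℝ} (hM : M.IsHermitian)

/-- The matrix with the eigenvectors of `M` and the eigenvalues `h λ`. -/
def specMap (hM : M.IsHermitian) (h : ℝ → ℝ) : Matrix (Fin n) (Fin n) ℝ :=
  (hM.eigenvectorUnitary : Matrix (Fin n) (Fin n) ℝ) *
    Matrix.diagonal (fun i => h (hM.eigenvalues i)) *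
    star (hM.eigenvectorUnitary : Matrix (Fin n) (Fin n) ℝ)

lemma specMap_id : specMap hM (fun t => t) = M := by
  conv_rhs => rw [hM.spectral_theorem, Unitary.conjStarAlgAut_apply]
  rfl

lemma specMap_mul (h₁ h₂ : ℝ → ℝ) :
    specMap hM h₁ * specMap hM h₂ = specMap hM (fun t => h₁ t * h₂ t) := by
  have hU : star (hM.eigenvectorUnitary : Matrix (Fin n) (Fin n) ℝ) *
      (hM.eigenvectorUnitary : Matrix (Fin n) (Fin n) ℝ) = 1 :=
    Unitary.coe_star_mul_self _
  simp only [specMap, ← Matrix.diagonal_mul_diagonal]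
  simp only [Matrix.mul_assoc]
  rw [← Matrix.mul_assoc (star _) (hM.eigenvectorUnitary : Matrix (Fin n) (Fin n) ℝ), hU,
    Matrix.one_mul]

lemma specMap_sub (h₁ h₂ : ℝ → ℝ) :
    specMap hM h₁ - specMap hM h₂ = specMap hM (fun t => h₁ t - h₂ t) := by
  simp only [specMap, ← Matrix.sub_mul, ← Matrix.mul_sub, Matrix.diagonal_sub]

lemma specMap_smul (c : ℝ) (h : ℝ → ℝ) :
    c • specMap hM h = specMap hM (fun t => c * h t) := by
  have : Matrix.diagonal (fun i => c * h (hM.eigenvalues i)) =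
      c • Matrix.diagonal (fun i => h (hM.eigenvalues i)) := by
    rw [← Matrix.diagonal_smul]; rfl
  simp only [specMap, this, Matrix.mul_smul, Matrix.smul_mul]

lemma specMap_congr {h₁ h₂ : ℝ → ℝ} (h : ∀ i, h₁ (hM.eigenvalues i) = h₂ (hM.eigenvalues i)) :
    specMap hM h₁ = specMap hM h₂ := by
  simp only [specMap, h]

lemma specMap_transpose (h : ℝ → ℝ) : (specMap hM h).transpose = specMap hM h := by
  simp [specMap, Matrix.star_eq_conjTranspose, Matrix.conjTranspose_eq_transpose_of_trivial,
    Matrix.mul_assoc]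

/-- The matrix is the square of the symmetric matrix with eigenvalues `√(h λ)`, so the form is a
squared norm. This is what reduces operator inequalities to scalar inequalities on the eigenvalues.
-/
lemma inner_act_specMap_nonneg {d : ℕ} {h : ℝ → ℝ} (hh : ∀ i, 0 ≤ h (hM.eigenvalues i))
    (x : Stack n d) : 0 ≤ inner ℝ x (act (specMap hM h) x) := by
  have : specMap hM h = specMap hM (fun t => √(h t)) * specMap hM (fun t => √(h t)) := by
    rw [specMap_mul]
    exact specMap_congr hM fun i => (Real.mul_self_sqrt (hh i)).symm
  rw [this, act_mul, ← inner_act (specMap_transpose hM _)]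
  exact real_inner_self_nonneg

lemma inner_act_specMap_le {d : ℕ} {h₁ h₂ : ℝ → ℝ}
    (hh : ∀ i, h₁ (hM.eigenvalues i) ≤ h₂ (hM.eigenvalues i)) (x : Stack n d) :
    inner ℝ x (act (specMap hM h₁) x) ≤ inner ℝ x (act (specMap hM h₂) x) := by
  have := inner_act_specMap_nonneg hM (h := fun t => h₂ t - h₁ t)
    (fun i => sub_nonneg.mpr (hh i)) x
  rw [← specMap_sub, act_sub, inner_sub_right] at this
  linarith

lemma norm_act_specMap_sq {d : ℕ} (h : ℝ → ℝ) (x : Stack n d) :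
    ‖act (specMap hM h) x‖ ^ 2 = inner ℝ x (act (specMap hM (fun t => h t * h t)) x) := by
  rw [← specMap_mul, act_mul, ← inner_act (specMap_transpose hM _), real_inner_self_eq_norm_sq]

/-- Since `toReal` sends `⊤` to `0`, the spectral radius must first be shown finite; this holds
because the spectrum is a finite set. -/
lemma abs_eigenvalues_le_rho (i : Fin n) : |hM.eigenvalues i| ≤ rho M := by
  have hmem := hM.eigenvalues_mem_spectrum_real i
  have hfin : spectralRadius ℝ M ≠ ⊤ := by
    rw [spectralRadius]
    obtain ⟨c, hc⟩ := (M.finite_real_spectrum.image fun k : ℝ => ‖k‖₊).bddAbove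
    refine ne_top_of_le_ne_top (ENNReal.coe_ne_top (r := c)) (iSup₂_le fun k hk => ?_)
    exact ENNReal.coe_le_coe.mpr (hc ⟨k, hk, rfl⟩)
  have hle : (‖hM.eigenvalues i‖₊ : ENNReal) ≤ spectralRadius ℝ M :=
    le_iSup₂ (α := ENNReal) (f := fun k (_ : k ∈ spectrum ℝ M) => (‖k‖₊ : ENNReal)) _ hmem
  have := ENNReal.toReal_mono hfin hle
  simpa [rho] using this

lemma rho2_le_eigenvalues {i : Fin n} (hi : 0 < hM.eigenvalues i) :
    rho2 M ≤ hM.eigenvalues i :=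
  csInf_le ⟨0, fun _ h => h.2.le⟩ ⟨hM.eigenvalues_mem_spectrum_real i, hi⟩

/-- The spectrum is finite, so the infimum is attained as soon as one positive eigenvalue exists. -/
lemma rho2_pos {i : Fin n} (hi : 0 < hM.eigenvalues i) : 0 < rho2 M := by
  have hfin : {μ : ℝ | μ ∈ spectrum ℝ M ∧ 0 < μ}.Finite :=
    M.finite_real_spectrum.subset fun _ h => h.1
  have hne : {μ : ℝ | μ ∈ spectrum ℝ M ∧ 0 < μ}.Nonempty :=
    ⟨_, hM.eigenvalues_mem_spectrum_real i, hi⟩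
  exact (hne.csInf_mem hfin).2

end Spectral

/-! ### The Laplacian of a connected graph -/

section Laplacian

variable {n : ℕ} {A : Matrix (Fin n) (Fin n) ℝ}

lemma laplacian_isHermitian (hA : IsUndirectedConnected A) : (laplacian A).IsHermitian := by
  rw [Matrix.IsHermitian, Matrix.conjTranspose_eq_transpose_of_trivial, laplacian,
    Matrix.transpose_sub, Matrix.diagonal_transpose, hA.symm]

lemma laplacian_mulVec (u : Fin n → ℝ) (i : Fin n) :
    (laplacian A).mulVec u i = ∑ j, A i j * (u i - u j) := by
  rw [laplacian, Matrix.sub_mulVec, Pi.sub_apply, Matrix.mulVec_diagonal]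
  simp only [Matrix.mulVec, dotProduct, mul_sub, Finset.sum_sub_distrib, Finset.sum_mul]

lemma dotProduct_laplacian (hA : IsUndirectedConnected A) (u : Fin n → ℝ) :
    2 * ∑ i, u i * (laplacian A).mulVec u i = ∑ i, ∑ j, A i j * (u i - u j) ^ 2 := by
  have h1 : ∑ i, u i * (laplacian A).mulVec u i = ∑ i, ∑ j, A i j * (u i * (u i - u j)) := by
    refine Finset.sum_congr rfl fun i _ => ?_
    rw [laplacian_mulVec, Finset.mul_sum]
    exact Finset.sum_congr rfl fun j _ => by ring
  have h2 : ∑ i, u i * (laplacian A).mulVec u i = ∑ i, ∑ j, A i j * (u j * (u j - u i)) := by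
    rw [h1, Finset.sum_comm]
    refine Finset.sum_congr rfl fun i _ => Finset.sum_congr rfl fun j _ => ?_
    rw [hA.symm.apply]
  rw [two_mul]
  nth_rewrite 1 [h1]
  rw [h2, ← Finset.sum_add_distrib]
  refine Finset.sum_congr rfl fun i _ => ?_
  rw [← Finset.sum_add_distrib]
  exact Finset.sum_congr rfl fun j _ => by ring

/-- The Dirichlet form vanishes, hence every summand does; `u` agrees across each edge and so along
walks of the connected graph. -/
lemma eq_of_laplacian_mulVec_eq_zero (hA : IsUndirectedConnected A) {u : Fin n → ℝ}
    (hu : (laplacian A).mulVec u = 0) (i j : Fin n) : u i = u j := by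
  have h0 := dotProduct_laplacian hA u
  simp only [hu, Pi.zero_apply, mul_zero, Finset.sum_const_zero] at h0
  have hnn : ∀ i j, 0 ≤ A i j * (u i - u j) ^ 2 := fun i j =>
    mul_nonneg (hA.nonneg i j) (sq_nonneg _)
  have hz : ∀ i j, A i j * (u i - u j) ^ 2 = 0 := fun i j =>
    (Finset.sum_eq_zero_iff_of_nonneg fun j _ => hnn i j).mp
      ((Finset.sum_eq_zero_iff_of_nonneg fun i _ => Finset.sum_nonneg fun j _ => hnn i j).mp
        h0.symm i (Finset.mem_univ i)) j (Finset.mem_univ j)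
  have hpos : ∀ i j, 0 < A i j → u i = u j := fun i j hij => by
    have := (mul_eq_zero.mp (hz i j)).resolve_left hij.ne'
    exact sub_eq_zero.mp (pow_eq_zero_iff two_ne_zero |>.mp this)
  obtain ⟨w⟩ := hA.connected.preconnected i j
  induction w with
  | nil => rfl
  | cons h _ ih =>
    rw [← ih]
    rcases ((SimpleGraph.fromRel_adj _ _ _).mp h).2 with h | h
    · exact hpos _ _ h
    · exact (hpos _ _ h).symm

lemma laplacian_eigenvalues_nonneg (hA : IsUndirectedConnected A) (i : Fin n) :
    0 ≤ (laplacian_isHermitian hA).eigenvalues i := by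
  refine Matrix.PosSemidef.eigenvalues_nonneg (A := laplacian A) ?_ i
  refine Matrix.PosSemidef.of_dotProduct_mulVec_nonneg (laplacian_isHermitian hA) fun u => ?_
  have h := dotProduct_laplacian hA u
  have : 0 ≤ ∑ i, ∑ j, A i j * (u i - u j) ^ 2 :=
    Finset.sum_nonneg fun i _ => Finset.sum_nonneg fun j _ =>
      mul_nonneg (hA.nonneg i j) (sq_nonneg _)
  simp only [dotProduct, star_trivial]
  linarith

/-- The orthogonal projection onto the vectors of mean zero. -/
def centering (n : ℕ) : Matrix (Fin n) (Fin n) ℝ :=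
  1 - (1 / (n : ℝ)) • Matrix.of (fun _ _ => 1)

lemma laplacian_mulVec_const (c : ℝ) : (laplacian A).mulVec (fun _ => c) = 0 := by
  ext i; simp [laplacian_mulVec]

/-- The Moore–Penrose inverse of the Laplacian. -/
def pinv (hA : IsUndirectedConnected A) : Matrix (Fin n) (Fin n) ℝ :=
  specMap (laplacian_isHermitian hA) (fun t => t⁻¹)

lemma pinv_mul_laplacian (hA : IsUndirectedConnected A) :
    pinv hA * laplacian A = specMap (laplacian_isHermitian hA) (fun t => t⁻¹ * t) := by
  rw [← specMap_mul, specMap_id, pinv]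

/-- With `0⁻¹ = 0`, the function `t⁻¹ * t` is the indicator of `t ≠ 0`, so the left side projects
onto the range of the Laplacian. The complement `1 - K` has columns in the kernel, hence constant;
it is symmetric with row sums `1`, which forces every entry to be `1 / n`. -/
lemma specMap_inv_mul_eq_centering (hA : IsUndirectedConnected A) :
    specMap (laplacian_isHermitian hA) (fun t => t⁻¹ * t) = centering n := by
  set hL := laplacian_isHermitian hA
  set K := specMap hL (fun t => t⁻¹ * t) with hK
  have hLK : laplacian A * (1 - K) = 0 := by
    have : laplacian A * K = laplacian A := by
      have h := specMap_mul hL (fun t => t) (fun t => t⁻¹ * t)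
      rw [specMap_id] at h
      refine h.trans (Eq.trans (specMap_congr hL fun i => ?_) (specMap_id hL))
      by_cases h : hL.eigenvalues i = 0
      · simp [h]
      · field_simp
    rw [mul_sub, mul_one, this, sub_self]
  have hcol : ∀ i i' j, (1 - K) i j = (1 - K) i' j := fun i i' j =>
    eq_of_laplacian_mulVec_eq_zero hA (u := fun i => (1 - K) i j)
      (by ext k; exact congrFun (congrFun hLK k) j) i i'
  have hsymm : ∀ i j, (1 - K) i j = (1 - K) j i := fun i j => by
    have : (1 - K).transpose = 1 - K := by
      rw [Matrix.transpose_sub, Matrix.transpose_one, hK, specMap_transpose]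
    exact congrFun (congrFun this j) i
  have hsum : ∀ i, ∑ j, (1 - K) i j = 1 := fun i => by
    have h1 : K.mulVec (fun _ => 1) = 0 := by
      rw [hK, ← pinv_mul_laplacian hA, ← Matrix.mulVec_mulVec, laplacian_mulVec_const,
        Matrix.mulVec_zero]
    have h2 : ∑ j, K i j = 0 := by
      have := congrFun h1 i
      simpa [Matrix.mulVec, dotProduct] using this
    simp [Matrix.sub_apply, Finset.sum_sub_distrib, h2, Matrix.one_apply]
  have hval : ∀ i j, (1 - K) i j = 1 / (n : ℝ) := fun i j => by
    have hconst : ∀ j', (1 - K) i j' = (1 - K) i j := fun j' => by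
      rw [hsymm i j', hcol j' j i, hsymm j i]
    have h := hsum i
    rw [Finset.sum_congr rfl fun j' _ => hconst j'] at h
    simp only [Finset.sum_const, Finset.card_univ, Fintype.card_fin, nsmul_eq_mul] at h
    have hn : (n : ℝ) ≠ 0 := by rintro h0; rw [h0] at h; simp at h
    field_simp
    linarith
  ext i j
  have h := hval i j
  simp only [centering, Matrix.sub_apply, Matrix.smul_apply, Matrix.of_apply, smul_eq_mul,
    mul_one] at h ⊢
  linarith

/-- Otherwise the Laplacian is zero and the indicator of one vertex lies in its kernel without being
constant; two vertices are needed for this. -/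
lemma exists_pos_eigenvalue (hn : 2 ≤ n) (hA : IsUndirectedConnected A) :
    ∃ i, 0 < (laplacian_isHermitian hA).eigenvalues i := by
  by_contra! hcon
  have h0 : ∀ i, (laplacian_isHermitian hA).eigenvalues i = 0 := fun i =>
    le_antisymm (hcon i) (laplacian_eigenvalues_nonneg hA i)
  have hL0 : laplacian A = 0 := (laplacian_isHermitian hA).eigenvalues_eq_zero_iff.mp (funext h0)
  have := eq_of_laplacian_mulVec_eq_zero hA (u := fun i => if i.val = 0 then 1 else 0)
    (by rw [hL0, Matrix.zero_mulVec]) ⟨0, by omega⟩ ⟨1, by omega⟩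
  simp at this

end Laplacian

/-- `L` is positive semidefinite with pseudo-inverse `Q`, the range of both is that of the
projection `K`, and the nonzero eigenvalues of `L` lie in `[ρ₂, ρ]`. -/
structure IsPseudoInverse {V : Type*} [NormedAddCommGroup V] [InnerProductSpace ℝ V]
    (L K Q : V →ₗ[ℝ] V) (ρ ρ₂ : ℝ) : Prop where
  L_symm : ∀ x y, inner ℝ (L x) y = inner ℝ x (L y)
  Q_symm : ∀ x y, inner ℝ (Q x) y = inner ℝ x (Q y)
  K_K : ∀ x, K (K x) = K x
  L_K : ∀ x, L (K x) = L x
  K_L : ∀ x, K (L x) = L x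
  Q_L : ∀ x, Q (L x) = K x
  norm_L_le : ∀ x, ‖L x‖ ≤ ρ * ‖x‖
  inner_L_le : ∀ x, inner ℝ x (L x) ≤ ρ * ‖x‖ ^ 2
  le_inner_L : ∀ x, ρ₂ * ‖K x‖ ^ 2 ≤ inner ℝ x (L x)
  norm_K_le : ∀ x, ‖K x‖ ^ 2 ≤ ρ * inner ℝ x (Q x)
  norm_Q_le : ∀ x, ρ₂ * ‖Q x‖ ^ 2 ≤ inner ℝ x (Q x)
  inner_Q_le : ∀ x, ρ₂ * inner ℝ x (Q x) ≤ ‖x‖ ^ 2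

/-- All three operators are functions of the same matrix, so each clause is a scalar relation
between `t`, `t⁻¹ * t` and `t⁻¹`. The inequalities are checked only at `t = 0` and on `[ρ₂, ρ]`. -/
lemma isPseudoInverse_specMap {n d : ℕ} {M : Matrix (Fin n) (Fin n) ℝ} (hM : M.IsHermitian)
    {ρ ρ₂ : ℝ} (hρ₀ : 0 ≤ ρ) (hρ₂ : 0 < ρ₂) (hρ : ∀ i, hM.eigenvalues i ≤ ρ)
    (hM' : ∀ i, hM.eigenvalues i = 0 ∨ ρ₂ ≤ hM.eigenvalues i) :
    IsPseudoInverse (V := Stack n d) (act (specMap hM fun t => t))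
      (act (specMap hM fun t => t⁻¹ * t)) (act (specMap hM fun t => t⁻¹)) ρ ρ₂ := by
  have e1 : ∀ x : Stack n d, ‖x‖ ^ 2 = inner ℝ x (act (specMap hM (fun _ => 1)) x) := fun x => by
    have : specMap hM (fun _ => 1) = 1 := by
      simp [specMap]
    rw [this, act_one, real_inner_self_eq_norm_sq]
  have key : ∀ (c : ℝ) (h₁ h₂ : ℝ → ℝ), c * h₁ 0 ≤ h₂ 0 →
      (∀ t, ρ₂ ≤ t → t ≤ ρ → c * h₁ t ≤ h₂ t) → ∀ x : Stack n d,
      c * inner ℝ x (act (specMap hM h₁) x) ≤ inner ℝ x (act (specMap hM h₂) x) := by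
    intro c h₁ h₂ h0 ht x
    rw [← real_inner_smul_right, ← act_smul, specMap_smul]
    refine inner_act_specMap_le hM (fun i => ?_) x
    rcases hM' i with h | h
    · simpa only [h] using h0
    · exact ht _ h (hρ i)
  have key' : ∀ (c : ℝ) (h₁ h₂ : ℝ → ℝ), h₁ 0 ≤ c * h₂ 0 →
      (∀ t, ρ₂ ≤ t → t ≤ ρ → h₁ t ≤ c * h₂ t) → ∀ x : Stack n d,
      inner ℝ x (act (specMap hM h₁) x) ≤ c * inner ℝ x (act (specMap hM h₂) x) := by
    intro c h₁ h₂ h0 ht x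
    rw [← real_inner_smul_right, ← act_smul, specMap_smul]
    refine inner_act_specMap_le hM (fun i => ?_) x
    rcases hM' i with h | h
    · simpa only [h] using h0
    · exact ht _ h (hρ i)
  have keymul : ∀ (h₁ h₂ h₃ : ℝ → ℝ), (∀ t, h₁ t * h₂ t = h₃ t) → ∀ x : Stack n d,
      act (specMap hM h₁) (act (specMap hM h₂) x) = act (specMap hM h₃) x := by
    intro h₁ h₂ h₃ h x
    rw [← act_mul, specMap_mul, funext h]
  have hinv : ∀ t : ℝ, t * (t⁻¹ * t) = t := fun t => by
    rcases eq_or_ne t 0 with h | h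
    · simp [h]
    · field_simp
  have hpos : ∀ t, ρ₂ ≤ t → 0 < t := fun t h => hρ₂.trans_le h
  refine ⟨inner_act (specMap_transpose hM _), inner_act (specMap_transpose hM _), keymul _ _ _ fun t => ?_, keymul _ _ _ hinv,
    keymul _ _ _ fun t => ?_, keymul _ _ _ fun t => rfl, fun x => ?_, fun x => ?_, fun x => ?_,
    fun x => ?_, fun x => ?_, fun x => ?_⟩
  · rw [mul_assoc, hinv]
  · rw [mul_comm, hinv]
  · refine abs_le_of_sq_le_sq' ?_ (by positivity) |>.2
    rw [norm_act_specMap_sq, mul_pow, e1]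
    refine key' _ _ _ (by simp; positivity) (fun t h h' => ?_) x
    have := hpos t h
    nlinarith
  · rw [e1]
    exact key' _ _ _ (by simpa using hρ₀) (fun t _ h' => by simpa using h') x
  · rw [norm_act_specMap_sq]
    refine key _ _ _ (by simp) (fun t h _ => ?_) x
    have := hpos t h
    rw [inv_mul_cancel₀ this.ne']
    linarith
  · rw [norm_act_specMap_sq]
    refine key' _ _ _ (by simp) (fun t h h' => ?_) x
    have := hpos t h
    rw [inv_mul_cancel₀ this.ne', ← div_eq_mul_inv, one_mul, le_div_iff₀ this]
    linarith
  · rw [norm_act_specMap_sq]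
    refine key _ _ _ (by simp) (fun t h _ => ?_) x
    have := hpos t h
    rw [← mul_assoc]
    refine mul_le_of_le_one_left (by positivity) ?_
    rwa [← div_eq_mul_inv, div_le_one this]
  · rw [e1]
    refine key _ _ _ (by simp) (fun t h _ => ?_) x
    rw [← div_eq_mul_inv, div_le_one (hpos t h)]
    exact h

/-! ### The Laplacian as an instance of the abstract operator triple -/

section Laplacian

variable {n : ℕ} {A : Matrix (Fin n) (Fin n) ℝ}

lemma rho2_laplacian_pos (hn : 2 ≤ n) (hA : IsUndirectedConnected A) : 0 < rho2 (laplacian A) := by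
  obtain ⟨i, hi⟩ := exists_pos_eigenvalue hn hA
  exact rho2_pos _ hi

lemma rho2_le_rho_laplacian (hn : 2 ≤ n) (hA : IsUndirectedConnected A) :
    rho2 (laplacian A) ≤ rho (laplacian A) := by
  obtain ⟨i, hi⟩ := exists_pos_eigenvalue hn hA
  exact (rho2_le_eigenvalues _ hi).trans ((le_abs_self _).trans (abs_eigenvalues_le_rho _ i))

lemma isPseudoInverse_laplacian (d : ℕ) (hn : 2 ≤ n) (hA : IsUndirectedConnected A) :
    IsPseudoInverse (V := Stack n d) (act (laplacian A)) (act (centering n)) (act (pinv hA))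
      (rho (laplacian A)) (rho2 (laplacian A)) := by
  have hpos := rho2_laplacian_pos hn hA
  have h := isPseudoInverse_specMap (d := d) (laplacian_isHermitian hA)
    (hpos.le.trans (rho2_le_rho_laplacian hn hA)) hpos
    (fun i => (le_abs_self _).trans (abs_eigenvalues_le_rho _ i)) (fun i => by
      rcases (laplacian_eigenvalues_nonneg hA i).eq_or_lt with h | h
      · exact Or.inl h.symm
      · exact Or.inr (rho2_le_eigenvalues _ h))
  rwa [specMap_id, specMap_inv_mul_eq_centering hA] at h

end Laplacian


/-! ### One step of the consensus part of the Lyapunov function -/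

section Lyapunov

variable {V : Type*} [NormedAddCommGroup V] [InnerProductSpace ℝ V]
  {L K Q : V →ₗ[ℝ] V} {ρ ρ₂ : ℝ}

/-- The consensus part of the Lyapunov function. -/
def lyap (Q : V →ₗ[ℝ] V) (τ : ℝ) (X W : V) : ℝ :=
  1 / 2 * ‖X‖ ^ 2 + (1 + τ) / 2 * inner ℝ W (Q W) + inner ℝ X (Q W)

/-- The choice `β = τγ` is made for this identity: the three parts of the form contribute `-αγ`, `(1
+ τ)αγ` and `-αβ` to the coefficient of `⟨X, W⟩`, and these cancel. Because `X - E` lies in the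
range of `K`, `Q` undoes `L` on it. -/
lemma lyap_step_eq (hT : IsPseudoInverse L K Q ρ ρ₂) {α β γ τ : ℝ} (hγ : γ ≠ 0)
    (hβ : β = τ * γ) {X E : V} (W G D : V) (hX : K X = X) (hE : K E = E) {Y : V}
    (hY : Y = β • L (X - E) + γ • W + G) :
    lyap Q τ (X - α • Y) (W + (α * γ) • L (X - E) + γ⁻¹ • D) = lyap Q τ X W
      + α * (-β * inner ℝ X (L X) + β * inner ℝ X (L E) + γ * ‖X‖ ^ 2 - γ * inner ℝ X E
        - inner ℝ X G - γ * inner ℝ W E - γ * inner ℝ W (Q W) - inner ℝ G (Q W))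
      + (β + γ) / γ ^ 2 * inner ℝ (Q W) D + γ⁻¹ * inner ℝ X (Q D)
      + α ^ 2 * (1 / 2 * ‖Y‖ ^ 2)
      + α ^ 2 * (-((β - γ) * γ / 2) * inner ℝ (X - E) (L (X - E))
        - γ ^ 2 * inner ℝ W (X - E) - γ * inner ℝ G (X - E))
      + α * inner ℝ (X - E) D - α * inner ℝ W (Q D) - α / γ * inner ℝ G (Q D)
      + (β + γ) / (2 * γ ^ 3) * inner ℝ D (Q D) := by
  obtain ⟨S, hS⟩ : ∃ S, S = X - E := ⟨_, rfl⟩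
  have hQLS : Q (L S) = S := by rw [hT.Q_L, hS, map_sub, hX, hE]
  rw [← hS] at hY ⊢
  have hXn : ‖X‖ ^ 2 = inner ℝ X X := (real_inner_self_eq_norm_sq X).symm
  have h1 : ‖X - α • Y‖ ^ 2 = ‖X‖ ^ 2 - 2 * α * inner ℝ X Y + α ^ 2 * ‖Y‖ ^ 2 := by
    rw [norm_sub_sq_real, real_inner_smul_right, norm_smul, mul_pow, Real.norm_eq_abs, sq_abs]
    ring
  have hXY : inner ℝ X Y = β * (inner ℝ X (L X) - inner ℝ X (L E)) + γ * inner ℝ X W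
      + inner ℝ X G := by
    rw [hY, hS, map_sub]
    simp only [inner_add_right, inner_sub_right, real_inner_smul_right]
  have hLW : inner ℝ (L S) (Q W) = inner ℝ S W := by rw [← hT.Q_symm, hQLS]
  have hLD : inner ℝ (L S) (Q D) = inner ℝ S D := by rw [← hT.Q_symm, hQLS]
  have hQ : Q (W + (α * γ) • L S + γ⁻¹ • D) = Q W + (α * γ) • S + γ⁻¹ • Q D := by
    simp only [map_add, map_smul, hQLS]
  have hWD : inner ℝ W (Q D) = inner ℝ (Q W) D := (hT.Q_symm W D).symm
  have hDW : inner ℝ D (Q W) = inner ℝ (Q W) D := real_inner_comm _ _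
  have h2 : inner ℝ (W + (α * γ) • L S + γ⁻¹ • D) (Q W + (α * γ) • S + γ⁻¹ • Q D) =
      inner ℝ W (Q W) + 2 * (α * γ) * inner ℝ W S + 2 * γ⁻¹ * inner ℝ (Q W) D
      + (α * γ) ^ 2 * inner ℝ S (L S) + 2 * (α * γ) * γ⁻¹ * inner ℝ S D
      + γ⁻¹ ^ 2 * inner ℝ D (Q D) := by
    simp only [inner_add_right, inner_add_left, real_inner_smul_right, real_inner_smul_left,
      hLW, hLD, hWD, hDW, real_inner_comm W S, real_inner_comm S (L S), real_inner_comm S D]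
    ring
  have h3 : inner ℝ (X - α • Y) (Q W + (α * γ) • S + γ⁻¹ • Q D) =
      inner ℝ X (Q W) + α * γ * inner ℝ X S + γ⁻¹ * inner ℝ X (Q D)
      - α * (β * inner ℝ W S + γ * inner ℝ W (Q W) + inner ℝ G (Q W))
      - α ^ 2 * γ * (β * inner ℝ S (L S) + γ * inner ℝ W S + inner ℝ G S)
      - α * γ⁻¹ * (β * inner ℝ S D + γ * inner ℝ (Q W) D + inner ℝ G (Q D)) := by
    rw [hY]
    simp only [inner_add_right, inner_add_left, inner_sub_left, real_inner_smul_right,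
      real_inner_smul_left, hLW, hLD, hWD, real_inner_comm W S, real_inner_comm S (L S)]
    ring
  have hXS : inner ℝ X S = ‖X‖ ^ 2 - inner ℝ X E := by rw [hS, inner_sub_right, hXn]
  have hWS : inner ℝ W S = inner ℝ X W - inner ℝ W E := by
    rw [hS, inner_sub_right, real_inner_comm]
  unfold lyap
  rw [hQ, h1, h2, h3, hXY, hXS, hWD, hWS, hβ]
  field_simp
  ring

lemma norm_sub_sq_le_two (X E : V) : ‖X - E‖ ^ 2 ≤ 2 * (‖X‖ ^ 2 + ‖E‖ ^ 2) := by
  have h := parallelogram_law_with_norm ℝ X E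
  nlinarith [sq_nonneg ‖X + E‖]

lemma neg_inner_le (X E : V) : -inner ℝ X E ≤ ‖X‖ * ‖E‖ :=
  (neg_le_abs _).trans (abs_real_inner_le_norm X E)

lemma IsPseudoInverse.norm_Q_le' (hT : IsPseudoInverse L K Q ρ ρ₂) (hρ₂ : 0 < ρ₂) (x : V) :
    ‖Q x‖ ≤ ‖x‖ / ρ₂ := by
  rw [le_div_iff₀ hρ₂, mul_comm]
  refine abs_le_of_sq_le_sq' ?_ (norm_nonneg x) |>.2
  have h1 := hT.norm_Q_le x
  have h2 := hT.inner_Q_le x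
  nlinarith

/-- The terms of first order in the stepsize. -/
lemma first_order_le (hT : IsPseudoInverse L K Q ρ ρ₂) (hρ₂ : 0 < ρ₂) (hρ : ρ₂ ≤ ρ)
    {α β γ ℓ p h : ℝ} (hα : 0 < α) (hβ : 0 < β) (hγ : 0 < γ)
    {X E W G D : V} (hX : K X = X) (hW : K W = W)
    (hG : ‖G‖ ^ 2 + h ^ 2 ≤ ℓ ^ 2 * ‖X‖ ^ 2) (hD : ‖D‖ ≤ α * (ℓ * p)) :
    α * (-β * inner ℝ X (L X) + β * inner ℝ X (L E) + γ * ‖X‖ ^ 2 - γ * inner ℝ X E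
        - inner ℝ X G - γ * inner ℝ W E - γ * inner ℝ W (Q W) - inner ℝ G (Q W))
      + (β + γ) / γ ^ 2 * inner ℝ (Q W) D + γ⁻¹ * inner ℝ X (Q D) ≤
    α * (-phi1 ρ₂ ℓ β γ * ‖X‖ ^ 2 - phi3 ρ₂ γ * inner ℝ W (Q W) + phi7 ρ β γ * ‖E‖ ^ 2
      + (1 / 8 - phi5 ρ₂ ℓ β γ) * p ^ 2 - 1 / 2 * h ^ 2) := by
  have hρ0 : 0 < ρ := hρ₂.trans_le hρ
  have hW2 := hT.norm_K_le W
  rw [hW] at hW2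
  have hWQ : 0 ≤ inner ℝ W (Q W) := by nlinarith [sq_nonneg ‖W‖]
  -- Nonnegativity of the form of `L` at `X - E` bounds `⟨X, L E⟩` by half of each diagonal term.
  have f1 : β * (-inner ℝ X (L X) + inner ℝ X (L E)) ≤
      β * (-(ρ₂ / 2) * ‖X‖ ^ 2 + ρ / 2 * ‖E‖ ^ 2) := by
    have h1 := hT.le_inner_L (X - E)
    have h2 : inner ℝ (X - E) (L (X - E)) =
        inner ℝ X (L X) - 2 * inner ℝ X (L E) + inner ℝ E (L E) := by
      rw [map_sub, inner_sub_right, inner_sub_left, inner_sub_left, ← hT.L_symm E X,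
        real_inner_comm X (L E)]
      ring
    have h3 := hT.le_inner_L X
    rw [hX] at h3
    have h4 := hT.inner_L_le E
    have h5 : 0 ≤ ρ₂ * ‖K (X - E)‖ ^ 2 := by positivity
    exact mul_le_mul_of_nonneg_left (by linarith) hβ.le
  have f2 : γ * (-inner ℝ X E) ≤ γ * (1 / 2 * ‖X‖ ^ 2 + ‖E‖ ^ 2) :=
    mul_le_mul_of_nonneg_left
      (by nlinarith [neg_inner_le X E, sq_nonneg (‖X‖ - ‖E‖), sq_nonneg ‖E‖]) hγ.le
  have f3 : -inner ℝ X G ≤ 1 / 2 * ‖X‖ ^ 2 + 1 / 2 * ‖G‖ ^ 2 := by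
    nlinarith [neg_inner_le X G, sq_nonneg (‖X‖ - ‖G‖)]
  -- The negative term `γ⟨W, Q W⟩` is spent in quarters: one here and one on the drift in `f6`. The
  -- remaining half is the `γ / 2` of `phi3`.
  have f4 : γ * (-inner ℝ W E) ≤ γ * (1 / 4 * inner ℝ W (Q W) + ρ * ‖E‖ ^ 2) := by
    refine mul_le_mul_of_nonneg_left ?_ hγ.le
    have h1 : ‖W‖ * ‖E‖ ≤ 1 / (4 * ρ) * ‖W‖ ^ 2 + ρ * ‖E‖ ^ 2 := by
      have : 1 / (4 * ρ) * ‖W‖ ^ 2 + ρ * ‖E‖ ^ 2 - ‖W‖ * ‖E‖ =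
          1 / ρ * (1 / 2 * ‖W‖ - ρ * ‖E‖) ^ 2 := by
        field_simp; ring
      have h0 : 0 ≤ 1 / ρ * (1 / 2 * ‖W‖ - ρ * ‖E‖) ^ 2 := by positivity
      linarith
    have h2 : 1 / (4 * ρ) * ‖W‖ ^ 2 ≤ 1 / 4 * inner ℝ W (Q W) := by
      rw [div_mul_eq_mul_div, div_le_iff₀ (by positivity)]
      linarith
    linarith [neg_inner_le W E]
  have hQW : ‖Q W‖ ^ 2 ≤ ρ₂⁻¹ * inner ℝ W (Q W) := by
    rw [← div_eq_inv_mul, le_div_iff₀ hρ₂]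
    linarith [hT.norm_Q_le W]
  have f5 : -inner ℝ G (Q W) ≤ 1 / 2 * ‖G‖ ^ 2 + 5 / 2 * (ρ₂⁻¹ * inner ℝ W (Q W)) := by
    have : 0 ≤ ρ₂⁻¹ * inner ℝ W (Q W) := by positivity
    nlinarith [neg_inner_le G (Q W), sq_nonneg (‖G‖ - ‖Q W‖)]
  have f6 : (β + γ) / γ ^ 2 * inner ℝ (Q W) D ≤
      α * (γ / 4 * inner ℝ W (Q W) + (β + γ) ^ 2 / γ ^ 5 * ρ₂⁻¹ * ℓ ^ 2 * p ^ 2) := by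
    have h1 : inner ℝ (Q W) D ≤ ‖Q W‖ * (α * (ℓ * p)) :=
      (real_inner_le_norm _ _).trans (mul_le_mul_of_nonneg_left hD (norm_nonneg _))
    have h2 : (β + γ) / γ ^ 2 * inner ℝ (Q W) D ≤
        (β + γ) / γ ^ 2 * (‖Q W‖ * (α * (ℓ * p))) :=
      mul_le_mul_of_nonneg_left h1 (by positivity)
    have h3 : α * (γ / 4 * (ρ₂ * ‖Q W‖ ^ 2) + (β + γ) ^ 2 / γ ^ 5 * ρ₂⁻¹ * ℓ ^ 2 * p ^ 2)
        - (β + γ) / γ ^ 2 * (‖Q W‖ * (α * (ℓ * p))) =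
        α * (γ * ρ₂) * (1 / 2 * ‖Q W‖ - (β + γ) / γ ^ 3 * ρ₂⁻¹ * (ℓ * p)) ^ 2 := by
      field_simp; ring
    have h4 : 0 ≤ α * (γ * ρ₂) * (1 / 2 * ‖Q W‖ - (β + γ) / γ ^ 3 * ρ₂⁻¹ * (ℓ * p)) ^ 2 := by
      positivity
    have h5 : α * (γ / 4 * (ρ₂ * ‖Q W‖ ^ 2)) ≤ α * (γ / 4 * inner ℝ W (Q W)) :=
      mul_le_mul_of_nonneg_left
        (mul_le_mul_of_nonneg_left (hT.norm_Q_le W) (by positivity)) hα.le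
    linarith
  have f7 : γ⁻¹ * inner ℝ X (Q D) ≤
      α * (1 / 2 * ‖X‖ ^ 2 + 1 / (2 * γ ^ 2) * ρ₂⁻¹ ^ 2 * ℓ ^ 2 * p ^ 2) := by
    have h1 : inner ℝ X (Q D) ≤ ‖X‖ * (α * (ℓ * p) / ρ₂) :=
      (real_inner_le_norm _ _).trans (mul_le_mul_of_nonneg_left
        ((hT.norm_Q_le' hρ₂ D).trans (by gcongr)) (norm_nonneg _))
    have h2 : γ⁻¹ * inner ℝ X (Q D) ≤ γ⁻¹ * (‖X‖ * (α * (ℓ * p) / ρ₂)) :=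
      mul_le_mul_of_nonneg_left h1 (by positivity)
    have h3 : α * (1 / 2 * ‖X‖ ^ 2 + 1 / (2 * γ ^ 2) * ρ₂⁻¹ ^ 2 * ℓ ^ 2 * p ^ 2)
        - γ⁻¹ * (‖X‖ * (α * (ℓ * p) / ρ₂)) =
        α / 2 * (‖X‖ - γ⁻¹ * ρ₂⁻¹ * (ℓ * p)) ^ 2 := by
      field_simp; ring
    have h4 : 0 ≤ α / 2 * (‖X‖ - γ⁻¹ * ρ₂⁻¹ * (ℓ * p)) ^ 2 := by positivity
    linarith
  -- The two halves of `‖G‖²` from `f3` and `f5` are replaced through `hG`. Half of the resulting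
  -- `-h²` is kept, to cancel the average gradient error in the optimality gap.
  have h8 : α * (-β * inner ℝ X (L X) + β * inner ℝ X (L E) + γ * ‖X‖ ^ 2 - γ * inner ℝ X E
        - inner ℝ X G - γ * inner ℝ W E - γ * inner ℝ W (Q W) - inner ℝ G (Q W)) ≤
      α * (β * (-(ρ₂ / 2) * ‖X‖ ^ 2 + ρ / 2 * ‖E‖ ^ 2) + γ * ‖X‖ ^ 2
        + γ * (1 / 2 * ‖X‖ ^ 2 + ‖E‖ ^ 2) + 1 / 2 * ‖X‖ ^ 2
        + γ * (1 / 4 * inner ℝ W (Q W) + ρ * ‖E‖ ^ 2) - γ * inner ℝ W (Q W)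
        + 5 / 2 * (ρ₂⁻¹ * inner ℝ W (Q W)) + (ℓ ^ 2 * ‖X‖ ^ 2 - 1 / 2 * h ^ 2)) :=
    mul_le_mul_of_nonneg_left (by nlinarith [sq_nonneg h]) hα.le
  refine (add_le_add (add_le_add h8 f6) f7).trans (le_of_eq ?_)
  rw [phi1, phi3, phi5, phi7]
  ring

/-- Weighted Cauchy–Schwarz: the reciprocals of the weights `24/5, 24/5, 3, 4` sum to `1`. The first
two are taken below `6`, so that half of them leaves a reserve of `3/5` under the coefficient `3` of
`ρ²β²` in the final bound. -/
lemma add_four_sq_le (a b c g : ℝ) : (a + b + c + g) ^ 2 ≤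
    24 / 5 * a ^ 2 + 24 / 5 * b ^ 2 + 3 * c ^ 2 + 4 * g ^ 2 := by
  nlinarith [sq_nonneg (a - b), sq_nonneg (24 / 5 * a - 3 * c), sq_nonneg (24 / 5 * b - 3 * c),
    sq_nonneg (24 / 5 * a - 4 * g), sq_nonneg (24 / 5 * b - 4 * g), sq_nonneg (3 * c - 4 * g)]

lemma add_four_sq_le' (a b c g : ℝ) : (a + b + c + g) ^ 2 ≤
    4 * (a ^ 2 + b ^ 2 + c ^ 2 + g ^ 2) := by
  nlinarith [sq_nonneg (a - b), sq_nonneg (a - c), sq_nonneg (b - c),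
    sq_nonneg (a - g), sq_nonneg (b - g), sq_nonneg (c - g)]

set_option maxHeartbeats 800000 in
/-- The terms of second order in the stepsize. -/
lemma second_order_le (hT : IsPseudoInverse L K Q ρ ρ₂) (hρ₂ : 0 < ρ₂) (hρ : ρ₂ ≤ ρ)
    {α β γ ℓ p η : ℝ} (hα : 0 < α) (hβ : 4 * γ ≤ ρ₂ * β) (hγ : 0 < γ) (hℓ : 0 < ℓ)
    (hγℓ : 2 * ℓ ≤ γ) (hη : 0 ≤ η)
    {X E W G D : V} (hW : K W = W)
    (hG : ‖G‖ ^ 2 ≤ ℓ ^ 2 * ‖X‖ ^ 2) (hD : ‖D‖ ≤ α * (ℓ * p)) {Y : V}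
    (hY : Y = β • L (X - E) + γ • W + G) :
    α ^ 2 * (1 / 2 * ‖Y‖ ^ 2)
      + α ^ 2 * (-((β - γ) * γ / 2) * inner ℝ (X - E) (L (X - E))
        - γ ^ 2 * inner ℝ W (X - E) - γ * inner ℝ G (X - E))
      + α * inner ℝ (X - E) D - α * inner ℝ W (Q D) - α / γ * inner ℝ G (Q D)
      + (β + γ) / (2 * γ ^ 3) * inner ℝ D (Q D) + η * (α ^ 2 * ‖Y‖ ^ 2) ≤
    α ^ 2 * (((3 + 4 * η) * ρ ^ 2 * β ^ 2 - ρ₂ * β * γ + (ρ + 2) * γ ^ 2 + 1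
        + (5 / 2 + 4 * η) * ℓ ^ 2) * ‖X‖ ^ 2
      + ((2 + 4 * η) * ρ * γ ^ 2 + 1 / 2 * ρ) * inner ℝ W (Q W)
      + ((3 + 4 * η) * ρ ^ 2 * β ^ 2 + (ρ - 2 * ρ₂) * β * γ + (ρ + 2) * γ ^ 2 + 1) * ‖E‖ ^ 2
      + (phi6 ρ₂ ℓ β γ - ℓ / 2) * p ^ 2) := by
  have hρ0 : 0 < ρ := hρ₂.trans_le hρ
  have hβ0 : 0 < β := pos_of_mul_pos_right (lt_of_lt_of_le (by positivity) hβ) hρ₂.le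
  have hW2 := hT.norm_K_le W
  rw [hW] at hW2
  have hS2 := norm_sub_sq_le_two X E
  have hSn : ‖X - E‖ ≤ ‖X‖ + ‖E‖ := norm_sub_le X E
  have hGn : ‖G‖ ≤ ℓ * ‖X‖ :=
    abs_le_of_sq_le_sq' (by rw [mul_pow]; exact hG) (by positivity) |>.2
  have hYn : ‖Y‖ ≤ ρ * β * ‖X‖ + ρ * β * ‖E‖ + γ * ‖W‖ + ‖G‖ := by
    rw [hY, map_sub]
    have h1 : ‖β • (L X - L E)‖ ≤ ρ * β * ‖X‖ + ρ * β * ‖E‖ := by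
      rw [norm_smul, Real.norm_of_nonneg hβ0.le]
      have := (norm_sub_le (L X) (L E)).trans (add_le_add (hT.norm_L_le X) (hT.norm_L_le E))
      have := mul_le_mul_of_nonneg_left this hβ0.le
      linarith
    have h2 : ‖γ • W‖ = γ * ‖W‖ := by rw [norm_smul, Real.norm_of_nonneg hγ.le]
    have := norm_add_le (β • (L X - L E) + γ • W) G
    have := norm_add_le (β • (L X - L E)) (γ • W)
    linarith
  have hYsq : ‖Y‖ ^ 2 ≤ (ρ * β * ‖X‖ + ρ * β * ‖E‖ + γ * ‖W‖ + ‖G‖) ^ 2 :=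
    pow_le_pow_left₀ (norm_nonneg _) hYn 2
  have hγW : γ ^ 2 * ‖W‖ ^ 2 ≤ γ ^ 2 * (ρ * inner ℝ W (Q W)) :=
    mul_le_mul_of_nonneg_left hW2 (by positivity)
  have s1 : 1 / 2 * ‖Y‖ ^ 2 ≤ 12 / 5 * (ρ ^ 2 * β ^ 2) * ‖X‖ ^ 2
      + 12 / 5 * (ρ ^ 2 * β ^ 2) * ‖E‖ ^ 2 + 3 / 2 * (γ ^ 2 * (ρ * inner ℝ W (Q W)))
      + 2 * (ℓ ^ 2 * ‖X‖ ^ 2) := by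
    have := add_four_sq_le (ρ * β * ‖X‖) (ρ * β * ‖E‖) (γ * ‖W‖) ‖G‖
    simp only [mul_pow] at this
    linarith
  have s2 : η * ‖Y‖ ^ 2 ≤ η * (4 * (ρ ^ 2 * β ^ 2 * ‖X‖ ^ 2 + ρ ^ 2 * β ^ 2 * ‖E‖ ^ 2
      + γ ^ 2 * (ρ * inner ℝ W (Q W)) + ℓ ^ 2 * ‖X‖ ^ 2)) := by
    refine mul_le_mul_of_nonneg_left ?_ hη
    have := add_four_sq_le' (ρ * β * ‖X‖) (ρ * β * ‖E‖) (γ * ‖W‖) ‖G‖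
    simp only [mul_pow] at this
    linarith
  have hSL : 0 ≤ inner ℝ (X - E) (L (X - E)) :=
    le_trans (by positivity) (hT.le_inner_L (X - E))
  -- Only the part with `γ²` is kept; the part with `βγ` has the favorable sign.
  have s3 : -((β - γ) * γ / 2) * inner ℝ (X - E) (L (X - E)) ≤
      γ ^ 2 * ρ * (‖X‖ ^ 2 + ‖E‖ ^ 2) := by
    have h1 : inner ℝ (X - E) (L (X - E)) ≤ ρ * (2 * (‖X‖ ^ 2 + ‖E‖ ^ 2)) :=
      (hT.inner_L_le _).trans (mul_le_mul_of_nonneg_left hS2 hρ0.le)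
    have h2 : 0 ≤ β * γ * inner ℝ (X - E) (L (X - E)) := by positivity
    have h3 := mul_le_mul_of_nonneg_left h1 (by positivity : 0 ≤ γ ^ 2 / 2)
    linarith
  have s4 : γ ^ 2 * (-inner ℝ W (X - E)) ≤ 1 / 2 * (γ ^ 2 * (ρ * inner ℝ W (Q W)))
      + γ ^ 2 * (‖X‖ ^ 2 + ‖E‖ ^ 2) := by
    have h1 : -inner ℝ W (X - E) ≤ 1 / 2 * ‖W‖ ^ 2 + (‖X‖ ^ 2 + ‖E‖ ^ 2) := by
      linarith [neg_inner_le W (X - E), two_mul_le_add_sq ‖W‖ ‖X - E‖]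
    have := mul_le_mul_of_nonneg_left h1 (sq_nonneg γ)
    linarith
  have s5 : γ * (-inner ℝ G (X - E)) ≤ γ ^ 2 * (‖X‖ ^ 2 + ‖E‖ ^ 2) := by
    have h1 : -inner ℝ G (X - E) ≤ (ℓ * ‖X‖) * (‖X‖ + ‖E‖) :=
      (neg_inner_le _ _).trans (mul_le_mul hGn hSn (norm_nonneg _) (by positivity))
    have h2 : ℓ * (‖X‖ * (‖X‖ + ‖E‖)) ≤ γ / 2 * (2 * (‖X‖ ^ 2 + ‖E‖ ^ 2)) :=
      mul_le_mul (by linarith) (by linarith [two_mul_le_add_sq ‖X‖ ‖E‖, sq_nonneg ‖E‖, sq_nonneg ‖X‖])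
        (by positivity) (by positivity)
    have := mul_le_mul_of_nonneg_left (h1.trans ((mul_assoc _ _ _).le.trans h2)) hγ.le
    linarith
  have hQD : ‖Q D‖ ≤ α * (ρ₂⁻¹ * (ℓ * p)) := by
    refine (hT.norm_Q_le' hρ₂ D).trans ?_
    rw [div_eq_mul_inv]
    have := mul_le_mul_of_nonneg_right hD (inv_nonneg.mpr hρ₂.le)
    linarith
  have s6 : α * inner ℝ (X - E) D ≤
      α ^ 2 * (‖X‖ ^ 2 + ‖E‖ ^ 2 + 1 / 2 * ℓ ^ 2 * p ^ 2) := by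
    have h1 : inner ℝ (X - E) D ≤ ‖X - E‖ * (α * (ℓ * p)) :=
      (real_inner_le_norm _ _).trans (mul_le_mul_of_nonneg_left hD (norm_nonneg _))
    have h2 := mul_le_mul_of_nonneg_left h1 hα.le
    have h3 : α ^ 2 * (‖X - E‖ * (ℓ * p)) ≤
        α ^ 2 * (‖X‖ ^ 2 + ‖E‖ ^ 2 + 1 / 2 * ℓ ^ 2 * p ^ 2) :=
      mul_le_mul_of_nonneg_left (by linarith [two_mul_le_add_sq ‖X - E‖ (ℓ * p)]) (sq_nonneg α)
    linarith
  have s7 : -(α * inner ℝ W (Q D)) ≤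
      α ^ 2 * (1 / 2 * (ρ * inner ℝ W (Q W)) + ρ₂⁻¹ ^ 2 / 2 * ℓ ^ 2 * p ^ 2) := by
    have h1 : -inner ℝ W (Q D) ≤ ‖W‖ * (α * (ρ₂⁻¹ * (ℓ * p))) :=
      (neg_inner_le _ _).trans (mul_le_mul_of_nonneg_left hQD (norm_nonneg _))
    have h2 := mul_le_mul_of_nonneg_left h1 hα.le
    have h3 : α ^ 2 * (‖W‖ * (ρ₂⁻¹ * (ℓ * p))) ≤
        α ^ 2 * (1 / 2 * (ρ * inner ℝ W (Q W)) + ρ₂⁻¹ ^ 2 / 2 * ℓ ^ 2 * p ^ 2) :=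
      mul_le_mul_of_nonneg_left (by linarith [two_mul_le_add_sq ‖W‖ (ρ₂⁻¹ * (ℓ * p))]) (sq_nonneg α)
    linarith
  have s8 : -(α / γ * inner ℝ G (Q D)) ≤
      α ^ 2 * (1 / 2 * (ℓ ^ 2 * ‖X‖ ^ 2) + 1 / (2 * γ ^ 2) * ρ₂⁻¹ ^ 2 * ℓ ^ 2 * p ^ 2) := by
    have h1 : -inner ℝ G (Q D) ≤ ‖G‖ * (α * (ρ₂⁻¹ * (ℓ * p))) :=
      (neg_inner_le _ _).trans (mul_le_mul_of_nonneg_left hQD (norm_nonneg _))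
    have h2 := mul_le_mul_of_nonneg_left h1 (by positivity : 0 ≤ α / γ)
    have h3 : α ^ 2 * (1 / 2 * ‖G‖ ^ 2 + 1 / (2 * γ ^ 2) * ρ₂⁻¹ ^ 2 * ℓ ^ 2 * p ^ 2)
        - α / γ * (‖G‖ * (α * (ρ₂⁻¹ * (ℓ * p)))) =
        α ^ 2 / 2 * (‖G‖ - γ⁻¹ * ρ₂⁻¹ * (ℓ * p)) ^ 2 := by
      field_simp; ring
    have h4 : 0 ≤ α ^ 2 / 2 * (‖G‖ - γ⁻¹ * ρ₂⁻¹ * (ℓ * p)) ^ 2 := by positivity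
    have h5 := mul_le_mul_of_nonneg_left hG (sq_nonneg α)
    linarith
  have s9 : (β + γ) / (2 * γ ^ 3) * inner ℝ D (Q D) ≤
      α ^ 2 * ((β + γ) / (2 * γ ^ 3) * ρ₂⁻¹ * ℓ ^ 2 * p ^ 2) := by
    have h1 : inner ℝ D (Q D) ≤ ρ₂⁻¹ * (α * (ℓ * p)) ^ 2 := by
      rw [← div_eq_inv_mul, le_div_iff₀ hρ₂, mul_comm]
      exact (hT.inner_Q_le D).trans (pow_le_pow_left₀ (norm_nonneg _) hD 2)
    have h2 := mul_le_mul_of_nonneg_left h1 (by positivity : 0 ≤ (β + γ) / (2 * γ ^ 3))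
    refine h2.trans (le_of_eq (by ring))
  -- The negative multiples of `βγ` in the target are covered, in `k1` and `k2`, by the reserve
  -- `3/5` of `ρ²β²` left by `add_four_sq_le`.
  have hkey : 4 * (ρ₂ * β * γ) ≤ ρ ^ 2 * β ^ 2 := by
    have h1 : ρ₂ * β * (4 * γ) ≤ ρ₂ * β * (ρ₂ * β) :=
      mul_le_mul_of_nonneg_left hβ (by positivity)
    have h2 : (ρ₂ * β) ^ 2 ≤ (ρ * β) ^ 2 := by gcongr
    linarith
  have hneg : 0 ≤ ρ₂ * β * γ := by positivity
  have hρβγ : ρ₂ * β * γ ≤ ρ * β * γ := by gcongr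
  have k1 : ρ₂ * β * γ * ‖X‖ ^ 2 ≤ 3 / 5 * (ρ ^ 2 * β ^ 2) * ‖X‖ ^ 2 :=
    mul_le_mul_of_nonneg_right (by linarith) (sq_nonneg _)
  have k2 : (2 * ρ₂ - ρ) * β * γ * ‖E‖ ^ 2 ≤ 3 / 5 * (ρ ^ 2 * β ^ 2) * ‖E‖ ^ 2 :=
    mul_le_mul_of_nonneg_right (by linarith) (sq_nonneg _)
  have hα2 := mul_le_mul_of_nonneg_left
    (add_le_add (add_le_add (add_le_add (add_le_add s1 s2) s3) (add_le_add s4 s5))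
      (add_le_add k1 k2)) (sq_nonneg α)
  rw [phi6]
  linarith

/-- One step of the consensus part of the Lyapunov function. -/
lemma lyap_step_le (hT : IsPseudoInverse L K Q ρ ρ₂) (hρ₂ : 0 < ρ₂) (hρ : ρ₂ ≤ ρ)
    {α β γ τ ℓ p h ω r δ : ℝ} (hα : 0 < α) (hτ : 4 / ρ₂ ≤ τ) (hβ : β = τ * γ) (hγ : 0 < γ)
    (hℓ : 0 < ℓ) (hγℓ : 2 * ℓ ≤ γ) (hη : 0 ≤ eps10 ω r δ)
    {X E W G D : V} (hX : K X = X) (hE : K E = E) (hW : K W = W)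
    (hG : ‖G‖ ^ 2 + h ^ 2 ≤ ℓ ^ 2 * ‖X‖ ^ 2) (hD : ‖D‖ ≤ α * (ℓ * p)) {Y : V}
    (hY : Y = β • L (X - E) + γ • W + G) :
    lyap Q τ (X - α • Y) (W + (α * γ) • L (X - E) + γ⁻¹ • D)
        + eps10 ω r δ * (α ^ 2 * ‖Y‖ ^ 2) ≤ lyap Q τ X W
      - α * (phi1 ρ₂ ℓ β γ - α * phi2' ρ ρ₂ ℓ β γ ω r δ) * ‖X‖ ^ 2
      - α * (phi3 ρ₂ γ - α * phi4' ρ γ ω r δ) * inner ℝ W (Q W)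
      + (α * phi7 ρ β γ + α ^ 2 * phi8' ρ ρ₂ β γ ω r δ) * ‖E‖ ^ 2
      + α * (1 / 8 - phi5 ρ₂ ℓ β γ + α * (phi6 ρ₂ ℓ β γ - ℓ / 2)) * p ^ 2
      - α / 2 * h ^ 2 := by
  have hβ4 : 4 * γ ≤ ρ₂ * β := by
    have := (div_le_iff₀ hρ₂).mp hτ
    rw [hβ]
    nlinarith
  have hβ0 : 0 < β := by
    by_contra! hc
    nlinarith
  have h1 := first_order_le hT hρ₂ hρ (E := E) hα hβ0 hγ hX hW hG hD
  have h2 := second_order_le hT hρ₂ hρ (E := E) hα hβ4 hγ hℓ hγℓ hη hW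
    (le_trans (le_add_of_nonneg_right (sq_nonneg h)) hG) hD hY
  rw [lyap_step_eq hT hγ.ne' hβ W G D hX hE hY, phi2', phi4', phi8']
  linarith

/-- Young's inequality with weight `τρ₂` for the cross term, followed by `ρ₂‖Q W‖² ≤ ⟨W, Q W⟩`,
produces the two entries of `eps2`. -/
lemma lyap_le (hT : IsPseudoInverse L K Q ρ ρ₂) (hρ₂ : 0 < ρ₂) {τ : ℝ} (hτ : 4 / ρ₂ ≤ τ)
    (X W : V) :
    lyap Q τ X W ≤ eps2 ρ₂ τ * (‖X‖ ^ 2 + inner ℝ W (Q W)) := by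
  have hτ0 : 0 < τ := lt_of_lt_of_le (by positivity) hτ
  have hQ := hT.norm_Q_le W
  have hWQ : 0 ≤ inner ℝ W (Q W) := le_trans (by positivity) hQ
  have h1 : inner ℝ X (Q W) ≤ τ * ρ₂ / 2 * ‖X‖ ^ 2 + 1 / (2 * τ * ρ₂ ^ 2) * inner ℝ W (Q W) := by
    have h2 : τ * ρ₂ / 2 * ‖X‖ ^ 2 + 1 / (2 * τ * ρ₂ ^ 2) * (ρ₂ * ‖Q W‖ ^ 2) - ‖X‖ * ‖Q W‖ =
        1 / (2 * τ * ρ₂) * (τ * ρ₂ * ‖X‖ - ‖Q W‖) ^ 2 := by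
      field_simp; ring
    have h3 : 0 ≤ 1 / (2 * τ * ρ₂) * (τ * ρ₂ * ‖X‖ - ‖Q W‖) ^ 2 := by positivity
    have h4 := mul_le_mul_of_nonneg_left hQ (by positivity : 0 ≤ 1 / (2 * τ * ρ₂ ^ 2))
    linarith [real_inner_le_norm X (Q W)]
  have h5 : (1 + τ * ρ₂) / 2 * ‖X‖ ^ 2 ≤ eps2 ρ₂ τ * ‖X‖ ^ 2 :=
    mul_le_mul_of_nonneg_right (le_max_left _ _) (sq_nonneg _)
  have h6 : ((1 + τ) / 2 + 1 / (2 * τ * ρ₂ ^ 2)) * inner ℝ W (Q W) ≤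
      eps2 ρ₂ τ * inner ℝ W (Q W) :=
    mul_le_mul_of_nonneg_right (le_max_right _ _) hWQ
  rw [lyap]
  linarith

/-- The bound `τ ≥ 4/ρ₂` makes the form in `W` dominate `2‖Q W‖²`, while the cross term costs at
most `‖X‖²/4 + ‖Q W‖²`. -/
lemma le_lyap (hT : IsPseudoInverse L K Q ρ ρ₂) (hρ₂ : 0 < ρ₂) {τ : ℝ} (hτ : 4 / ρ₂ ≤ τ)
    (X W : V) : 1 / 4 * ‖X‖ ^ 2 ≤ lyap Q τ X W := by
  have hQ := hT.norm_Q_le W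
  have hWQ : 0 ≤ inner ℝ W (Q W) := le_trans (by positivity) hQ
  have h1 : 4 * ‖Q W‖ ^ 2 ≤ τ * inner ℝ W (Q W) := by
    have h2 := mul_le_mul_of_nonneg_right hτ hWQ
    have h3 := mul_le_mul_of_nonneg_left hQ (by positivity : 0 ≤ 4 / ρ₂)
    have h4 : 4 / ρ₂ * (ρ₂ * ‖Q W‖ ^ 2) = 4 * ‖Q W‖ ^ 2 := by field_simp
    linarith
  rw [lyap]
  nlinarith [neg_inner_le X (Q W), sq_nonneg (‖X‖ - 2 * ‖Q W‖), sq_nonneg ‖Q W‖]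

end Lyapunov


/-! ### Smooth functions -/

lemma IsSmoothWith.continuous_gradient {d : ℕ} {ℓ : ℝ} {h : EuclideanSpace ℝ (Fin d) → ℝ}
    (hh : IsSmoothWith ℓ h) : Continuous (gradient h) := by
  refine (LipschitzWith.of_dist_le_mul (K := ℓ.toNNReal) fun x y => ?_).continuous
  rw [dist_eq_norm, dist_eq_norm]
  exact (hh.2 x y).trans (mul_le_mul_of_nonneg_right (Real.le_coe_toNNReal ℓ) (norm_nonneg _))

/-- The descent lemma. -/
lemma IsSmoothWith.le_quadratic {d : ℕ} {ℓ : ℝ} {h : EuclideanSpace ℝ (Fin d) → ℝ}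
    (hh : IsSmoothWith ℓ h) (x u : EuclideanSpace ℝ (Fin d)) :
    h (x + u) ≤ h x + inner ℝ (gradient h x) u + ℓ / 2 * ‖u‖ ^ 2 := by
  -- The defect of the quadratic bound along the segment; the Lipschitz gradient makes its
  -- derivative nonpositive, and the claim compares `ψ 1` with `ψ 0`.
  let ψ : ℝ → ℝ := fun t => h (x + t • u) - t * inner ℝ (gradient h x) u - ℓ / 2 * t ^ 2 * ‖u‖ ^ 2
  have hψ : ∀ t, HasDerivAt ψ (inner ℝ (gradient h (x + t • u)) u - inner ℝ (gradient h x) u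
      - ℓ * t * ‖u‖ ^ 2) t := fun t => by
    have hline : HasDerivAt (fun t : ℝ => x + t • u) u t := by
      simpa using ((hasDerivAt_id t).smul_const u).const_add x
    have h1 := (hh.1 (x + t • u)).hasFDerivAt.comp_hasDerivAt t hline
    rw [← inner_gradient_left] at h1
    have h2 : HasDerivAt (fun t : ℝ => t * inner ℝ (gradient h x) u)
        (inner ℝ (gradient h x) u) t := by
      simpa using (hasDerivAt_id t).mul_const (inner ℝ (gradient h x) u)
    have h3 : HasDerivAt (fun t : ℝ => ℓ / 2 * t ^ 2 * ‖u‖ ^ 2) (ℓ * t * ‖u‖ ^ 2) t := by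
      convert! (((hasDerivAt_id t).pow 2).const_mul (ℓ / 2)).mul_const (‖u‖ ^ 2) using 1
      simp only [id, Nat.cast_ofNat]; ring
    exact (h1.sub h2).sub h3
  have hanti : AntitoneOn ψ (Set.Icc 0 1) := by
    refine antitoneOn_of_deriv_nonpos (convex_Icc 0 1)
      (fun t _ => (hψ t).continuousAt.continuousWithinAt)
      (fun t _ => (hψ t).differentiableAt.differentiableWithinAt) fun t ht => ?_
    rw [interior_Icc] at ht
    rw [(hψ t).deriv, ← inner_sub_left, sub_nonpos]
    refine (real_inner_le_norm _ _).trans ?_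
    have h1 := hh.2 (x + t • u) x
    rw [add_sub_cancel_left, norm_smul, Real.norm_of_nonneg ht.1.le] at h1
    have := mul_le_mul_of_nonneg_right h1 (norm_nonneg u)
    linarith
  have := hanti (Set.left_mem_Icc.mpr zero_le_one) (Set.right_mem_Icc.mpr zero_le_one) zero_le_one
  simp only [ψ, one_smul, zero_smul, add_zero] at this
  linarith

section Cost

variable {n d : ℕ} {f : Fin n → EuclideanSpace ℝ (Fin d) → ℝ} {ℓ : ℝ}

lemma gradient_globalCost (hf : ∀ i, IsSmoothWith ℓ (f i)) (x : EuclideanSpace ℝ (Fin d)) :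
    gradient (globalCost f) x = average fun i => gradient (f i) x := by
  refine HasGradientAt.gradient ?_
  rw [hasGradientAt_iff_hasFDerivAt]
  have h := (HasFDerivAt.fun_sum fun i (_ : i ∈ Finset.univ) =>
    ((hf i).1 x).hasFDerivAt).const_mul (1 / (n : ℝ))
  convert! h using 1
  rw [average, map_smul, map_sum]
  simp only [toDual_gradient]

lemma norm_average_sub_le (hn : 0 < n) {a b : Fin n → EuclideanSpace ℝ (Fin d)} {c : ℝ}
    (h : ∀ i, ‖a i - b i‖ ≤ c) : ‖average a - average b‖ ≤ c := by
  rw [average, average, ← smul_sub, ← Finset.sum_sub_distrib, norm_smul,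
    Real.norm_of_nonneg (by positivity)]
  have h1 : ‖∑ i, (a i - b i)‖ ≤ ∑ _i : Fin n, c :=
    (norm_sum_le _ _).trans (Finset.sum_le_sum fun i _ => h i)
  rw [Finset.sum_const, Finset.card_univ, Fintype.card_fin, nsmul_eq_mul] at h1
  have hn' : (0 : ℝ) < n := by exact_mod_cast hn
  rw [one_div, inv_mul_le_iff₀ hn']
  exact h1

lemma isSmoothWith_globalCost (hn : 0 < n) (hf : ∀ i, IsSmoothWith ℓ (f i)) :
    IsSmoothWith ℓ (globalCost f) := by
  refine ⟨fun x => ?_, fun x y => ?_⟩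
  · exact (DifferentiableAt.fun_sum fun i _ => (hf i).1 x).const_mul _
  · rw [gradient_globalCost hf, gradient_globalCost hf]
    exact norm_average_sub_le hn fun i => (hf i).2 x y

end Cost

/-! ### Averages of stacked vectors -/

section Average

variable {n d : ℕ}

/-- The stacked vector with all components equal to `u`. -/
def constStack (n : ℕ) {d : ℕ} (u : EuclideanSpace ℝ (Fin d)) : Stack n d :=
  WithLp.toLp 2 fun _ => u

/-- The average of the components of a stacked vector. -/
def avg (x : Stack n d) : EuclideanSpace ℝ (Fin d) := average x.ofLp

lemma norm_stack_sq (x : Stack n d) : ‖x‖ ^ 2 = ∑ i, ‖x i‖ ^ 2 := PiLp.norm_sq_eq_of_L2 _ x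

lemma norm_constStack_sq (u : EuclideanSpace ℝ (Fin d)) : ‖constStack n u‖ ^ 2 = n * ‖u‖ ^ 2 := by
  rw [norm_stack_sq]
  simp [constStack]

lemma act_centering (x : Stack n d) : act (centering n) x = x - constStack n (avg x) := by
  rw [centering, act_sub, act_one, act_smul]
  congr 1
  ext1 i
  simp [constStack, avg, average]

lemma avg_add (x y : Stack n d) : avg (x + y) = avg x + avg y := by
  simp [avg, average, Finset.sum_add_distrib]

lemma avg_sub (x y : Stack n d) : avg (x - y) = avg x - avg y := by
  simp [avg, average, Finset.sum_sub_distrib, smul_sub]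

lemma avg_smul (c : ℝ) (x : Stack n d) : avg (c • x) = c • avg x := by
  simp [avg, average, ← Finset.smul_sum, smul_comm c]

lemma avg_constStack (hn : 0 < n) (u : EuclideanSpace ℝ (Fin d)) : avg (constStack n u) = u := by
  have : (n : ℝ) ≠ 0 := by positivity
  simp [avg, average, constStack, ← Nat.cast_smul_eq_nsmul ℝ, smul_smul, this]

lemma inner_constStack (x : Stack n d) (u : EuclideanSpace ℝ (Fin d)) :
    inner ℝ x (constStack n u) = n * inner ℝ (avg x) u := by
  rw [PiLp.inner_apply]
  have h : (n : ℝ) * inner ℝ (avg x) u = ∑ i, inner ℝ (x i) u := by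
    rcases Nat.eq_zero_or_pos n with rfl | hn
    · simp
    · have : (n : ℝ) ≠ 0 := by positivity
      rw [avg, average, real_inner_smul_left, sum_inner]
      field_simp
  rw [h]
  rfl

/-- The decomposition of a stacked vector into its centered part and its average is orthogonal. -/
lemma norm_sq_eq_centering_add (hn : 0 < n) (x : Stack n d) :
    ‖x‖ ^ 2 = ‖act (centering n) x‖ ^ 2 + ‖constStack n (avg x)‖ ^ 2 := by
  have h0 : inner ℝ (act (centering n) x) (constStack n (avg x)) = 0 := by
    rw [inner_constStack, act_centering, avg_sub, avg_constStack hn, sub_self, inner_zero_left,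
      mul_zero]
  have h1 : x = act (centering n) x + constStack n (avg x) := by rw [act_centering]; abel
  conv_lhs => rw [h1]
  rw [norm_add_sq_real, h0]
  ring

lemma norm_centering_le (hn : 0 < n) (x : Stack n d) : ‖act (centering n) x‖ ≤ ‖x‖ := by
  refine abs_le_of_sq_le_sq' ?_ (norm_nonneg x) |>.2
  rw [norm_sq_eq_centering_add hn x]
  exact le_add_of_nonneg_right (sq_nonneg _)

end Average


/-! ### Consequences of the parameter choice -/

lemma eps9_pos {ω r δ : ℝ} (hr : 0 < r) (hδ : 0 < δ) (hω : 0 < ω) : 0 < eps9 ω r δ := by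
  rw [eps9]; positivity

lemma two_mul_eps9_le_one {ω r δ : ℝ} (hr : 0 < r) (hδ : δ ∈ Set.Ioc (0 : ℝ) 1)
    (hω : ω ∈ Set.Ioc (0 : ℝ) (1 / r)) : 2 * eps9 ω r δ ≤ 1 := by
  have h1 : ω * r ≤ 1 := (le_div_iff₀ hr).mp hω.2
  have h2 : ω * r * δ ≤ 1 := mul_le_one₀ h1 hδ.1.le hδ.2
  rw [eps9]; linarith

/-- What the convergence proof uses of the parameters. -/
structure Admissible (ρ ρ₂ ℓ α β γ τ ω r δ : ℝ) : Prop where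
  rho2_pos : 0 < ρ₂
  rho2_le : ρ₂ ≤ ρ
  ell_pos : 0 < ℓ
  alpha_pos : 0 < α
  tau_ge : 4 / ρ₂ ≤ τ
  beta_eq : β = τ * γ
  gamma_pos : 0 < γ
  gamma_ge : 2 * ℓ ≤ γ
  eps9_pos : 0 < eps9 ω r δ
  eps9_le : 2 * eps9 ω r δ ≤ 1
  eps10_nonneg : 0 ≤ eps10 ω r δ
  alpha_eps10_le : α * eps10 ω r δ ≤ 3 / 8
  phi12 : 0 < phi1 ρ₂ ℓ β γ - α * phi2' ρ ρ₂ ℓ β γ ω r δ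
  phi34 : 0 < phi3 ρ₂ γ - α * phi4' ρ γ ω r δ
  phi56 : 0 < phi5 ρ₂ ℓ β γ - α * phi6 ρ₂ ℓ β γ
  phi78_nonneg : 0 ≤ α * phi7 ρ β γ + α ^ 2 * phi8' ρ ρ₂ β γ ω r δ
  phi78 : 0 < 2 * eps12 ω r δ - α * phi7 ρ β γ - α ^ 2 * phi8' ρ ρ₂ β γ ω r δ

/-- A positive `α` below each quotient gives the sign conditions once the denominators are known to
be positive. The negative terms of `phi2'` and `phi8'` are dominated by `ρ²β²`, because `4γ ≤ ρ₂β`.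
-/
lemma admissible {ρ ρ₂ ℓ α β γ τ ω r δ : ℝ} (hρ₂ : 0 < ρ₂) (hρ : ρ₂ ≤ ρ) (hℓ : 0 < ℓ)
    (hr : 0 < r) (hδ : δ ∈ Set.Ioc (0 : ℝ) 1) (hω : ω ∈ Set.Ioc (0 : ℝ) (1 / r))
    (hτ : kappa1 ρ₂ ≤ τ) (hβ : β = τ * γ) (hγ : kappa2 ρ₂ ℓ < γ)
    (hα : α ∈ Set.Ioo (0 : ℝ) (kappa0' ρ ρ₂ ℓ β γ ω r δ)) :
    Admissible ρ ρ₂ ℓ α β γ τ ω r δ := by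
  have hρ0 : 0 < ρ := hρ₂.trans_le hρ
  have h9 := eps9_pos hr hδ.1 hω.1
  have h9' := two_mul_eps9_le_one hr hδ hω
  have h10 : 0 ≤ eps10 ω r δ := by
    rw [eps10]
    exact mul_nonneg (by linarith) (by positivity)
  have hγ2 : 2 + 2 * ℓ ^ 2 < γ :=
    lt_of_le_of_lt ((le_max_left _ _).trans (le_max_left _ _)) hγ
  have hγ0 : 0 < γ := by linarith [sq_nonneg ℓ]
  have hγℓ : 2 * ℓ ≤ γ := by linarith [two_mul_le_add_sq ℓ 1, sq_nonneg ℓ]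
  have hτ0 : 4 / ρ₂ ≤ τ := hτ
  have hβ4 : 4 * γ ≤ ρ₂ * β := by
    have := mul_le_mul_of_nonneg_right ((div_le_iff₀ hρ₂).mp hτ0) hγ0.le
    rw [hβ]
    linarith
  have hβ0 : 0 < β := pos_of_mul_pos_right (lt_of_lt_of_le (by positivity) hβ4) hρ₂.le
  have hkey : 4 * (ρ₂ * β * γ) ≤ ρ ^ 2 * β ^ 2 := by
    have h1 : ρ₂ * β * (4 * γ) ≤ ρ₂ * β * (ρ₂ * β) :=
      mul_le_mul_of_nonneg_left hβ4 (by positivity)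
    have h2 : (ρ₂ * β) ^ 2 ≤ (ρ * β) ^ 2 := by gcongr
    linarith
  have hc : 0 < ρ₂ * β * γ := by positivity
  have h2' : 4 * eps10 ω r δ * (ρ ^ 2 * β ^ 2) < phi2' ρ ρ₂ ℓ β γ ω r δ := by
    have e1 : 0 ≤ (ρ + 2) * γ ^ 2 := by positivity
    have e2 : 0 ≤ (5 / 2 + 4 * eps10 ω r δ) * ℓ ^ 2 := by positivity
    rw [phi2']
    linarith
  have h2pos : 0 < phi2' ρ ρ₂ ℓ β γ ω r δ := lt_of_le_of_lt (by positivity) h2'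
  have h4pos : 0 < phi4' ρ γ ω r δ := by rw [phi4']; positivity
  have h6pos : 0 < phi6 ρ₂ ℓ β γ := by rw [phi6]; positivity
  have h7pos : 0 < phi7 ρ β γ := by rw [phi7]; positivity
  have h8pos : 0 < phi8' ρ ρ₂ β γ ω r δ := by
    have e1 : 0 ≤ (ρ + 2) * γ ^ 2 := by positivity
    have e2 : 0 ≤ 4 * eps10 ω r δ * (ρ ^ 2 * β ^ 2) := by positivity
    have e3 : 0 ≤ ρ * β * γ := by positivity
    rw [phi8']
    linarith
  obtain ⟨⟨ha1, ha2⟩, ha3, ha4⟩ : ((α < phi1 ρ₂ ℓ β γ / phi2' ρ ρ₂ ℓ β γ ω r δ) ∧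
      (α < phi3 ρ₂ γ / phi4' ρ γ ω r δ)) ∧ (α < phi5 ρ₂ ℓ β γ / phi6 ρ₂ ℓ β γ) ∧
      (α < (√(phi7 ρ β γ ^ 2 + 8 * eps12 ω r δ * phi8' ρ ρ₂ β γ ω r δ) - phi7 ρ β γ)
        / (2 * phi8' ρ ρ₂ β γ ω r δ)) := by
    have := hα.2
    rw [kappa0'] at this
    simpa only [lt_min_iff] using this
  rw [lt_div_iff₀ h2pos] at ha1
  rw [lt_div_iff₀ h4pos] at ha2
  rw [lt_div_iff₀ h6pos] at ha3
  rw [lt_div_iff₀ (by positivity)] at ha4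
  have h12 : 0 < eps12 ω r δ := by rw [eps12]; positivity
  -- The last entry of the stepsize bound is the positive root of `φ₈' t² + φ₇ t - 2ε₁₂`; squaring
  -- recovers the sign of this quadratic at `α`.
  have hroot : (2 * α * phi8' ρ ρ₂ β γ ω r δ + phi7 ρ β γ) ^ 2 <
      phi7 ρ β γ ^ 2 + 8 * eps12 ω r δ * phi8' ρ ρ₂ β γ ω r δ := by
    rw [← Real.lt_sqrt (by have := hα.1; positivity)]
    linarith
  have h78 : 0 < 2 * eps12 ω r δ - α * phi7 ρ β γ - α ^ 2 * phi8' ρ ρ₂ β γ ω r δ := by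
    have : 0 < 4 * phi8' ρ ρ₂ β γ ω r δ *
        (2 * eps12 ω r δ - α * phi7 ρ β γ - α ^ 2 * phi8' ρ ρ₂ β γ ω r δ) := by linarith
    exact pos_of_mul_pos_right this (by positivity)
  have hα0 := hα.1
  refine ⟨hρ₂, hρ, hℓ, hα0, hτ0, hβ, hγ0, hγℓ, h9, h9', h10, ?_,
    by linarith, by linarith, by linarith, by positivity, h78⟩
  have h1le : phi1 ρ₂ ℓ β γ ≤ 1 / 2 * (ρ₂ * β) := by
    rw [phi1]
    linarith [sq_nonneg ℓ]
  -- The bound on `α ε₁₀` comes from the first quotient: `4ε₁₀ρ²β² < φ₂'`, while `αφ₂' < φ₁ ≤ ρ₂β/2`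
  -- and `ρ₂β ≤ ρ²β²`.
  have hm : α * (4 * eps10 ω r δ * (ρ ^ 2 * β ^ 2)) ≤ 1 / 2 * (ρ₂ * β) :=
    (mul_le_mul_of_nonneg_left h2'.le hα0.le).trans (ha1.le.trans h1le)
  have hsq : ρ₂ * β ≤ ρ ^ 2 * β ^ 2 := by
    have h1 : 1 ≤ ρ₂ * β := by linarith [sq_nonneg ℓ]
    have h2 : (ρ₂ * β) ^ 2 ≤ (ρ * β) ^ 2 := by gcongr
    rw [← mul_pow]
    exact (le_self_pow₀ h1 two_ne_zero).trans h2
  have hpos : 0 < ρ ^ 2 * β ^ 2 := by positivity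
  have : α * eps10 ω r δ * (ρ ^ 2 * β ^ 2) ≤ 3 / 8 * (ρ ^ 2 * β ^ 2) := by linarith
  exact le_of_mul_le_mul_right this hpos

section Rate

variable {ρ ρ₂ ℓ α β γ τ ω r δ : ℝ}

lemma Admissible.one_le_eps2 (h : Admissible ρ ρ₂ ℓ α β γ τ ω r δ) : 1 ≤ eps2 ρ₂ τ := by
  refine le_trans ?_ (le_max_left _ _)
  have := (div_le_iff₀ h.rho2_pos).mp h.tau_ge
  linarith

lemma Admissible.eps6_pos (h : Admissible ρ ρ₂ ℓ α β γ τ ω r δ) {ν : ℝ} (hν : 0 < ν) :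
    0 < eps6' ρ ρ₂ ℓ ν α β γ τ ω r δ := by
  refine div_pos (lt_min (by positivity) (lt_min (lt_min h.phi12 h.phi34) ?_))
    (zero_lt_one.trans_le h.one_le_eps2)
  exact div_pos h.phi78 h.alpha_pos

lemma Admissible.eps6_mul_eps2 (h : Admissible ρ ρ₂ ℓ α β γ τ ω r δ) (ν : ℝ) :
    eps6' ρ ρ₂ ℓ ν α β γ τ ω r δ * eps2 ρ₂ τ ≤ ν / 2 ∧
    eps6' ρ ρ₂ ℓ ν α β γ τ ω r δ * eps2 ρ₂ τ ≤
      phi1 ρ₂ ℓ β γ - α * phi2' ρ ρ₂ ℓ β γ ω r δ ∧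
    eps6' ρ ρ₂ ℓ ν α β γ τ ω r δ * eps2 ρ₂ τ ≤ phi3 ρ₂ γ - α * phi4' ρ γ ω r δ ∧
    α * (eps6' ρ ρ₂ ℓ ν α β γ τ ω r δ * eps2 ρ₂ τ) ≤
      2 * eps12 ω r δ - α * phi7 ρ β γ - α ^ 2 * phi8' ρ ρ₂ β γ ω r δ := by
  have h2 : eps2 ρ₂ τ ≠ 0 := (zero_lt_one.trans_le h.one_le_eps2).ne'
  rw [eps6', div_mul_cancel₀ _ h2, eps3']
  refine ⟨min_le_left _ _, (min_le_right _ _).trans ((min_le_left _ _).trans (min_le_left _ _)),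
    (min_le_right _ _).trans ((min_le_left _ _).trans (min_le_right _ _)), ?_⟩
  rw [← le_div_iff₀' h.alpha_pos]
  exact (min_le_right _ _).trans (min_le_right _ _)

end Rate

/-! ### One step of the Lyapunov function -/

section Descent

variable {n d : ℕ}

/-- The stacked gradients of the local costs. -/
def gradStack (f : Fin n → EuclideanSpace ℝ (Fin d) → ℝ) (x : Stack n d) : Stack n d :=
  WithLp.toLp 2 fun i => gradient (f i) (x i)

/-- The stacked gradients of the local costs at the average. -/
def gradAvg (f : Fin n → EuclideanSpace ℝ (Fin d) → ℝ) (x : Stack n d) : Stack n d :=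
  gradStack f (constStack n (avg x))

/-- The Lyapunov function, up to the compression error. -/
def lyapunov (f : Fin n → EuclideanSpace ℝ (Fin d) → ℝ) (Q : Stack n d →ₗ[ℝ] Stack n d)
    (τ γ : ℝ) (x v : Stack n d) : ℝ :=
  lyap Q τ (act (centering n) x) (act (centering n) (v + γ⁻¹ • gradAvg f x))
    + n * (globalCost f (avg x) - optValue f)

lemma norm_gradStack_sub_sq_le {f : Fin n → EuclideanSpace ℝ (Fin d) → ℝ} {ℓ : ℝ}
    (hf : ∀ i, IsSmoothWith ℓ (f i)) (x y : Stack n d) :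
    ‖gradStack f x - gradStack f y‖ ^ 2 ≤ ℓ ^ 2 * ‖x - y‖ ^ 2 := by
  rw [norm_stack_sq, norm_stack_sq, Finset.mul_sum]
  refine Finset.sum_le_sum fun i _ => ?_
  rw [← mul_pow]
  exact pow_le_pow_left₀ (norm_nonneg _) ((hf i).2 (x i) (y i)) 2

lemma avg_gradAvg {f : Fin n → EuclideanSpace ℝ (Fin d) → ℝ} {ℓ : ℝ}
    (hf : ∀ i, IsSmoothWith ℓ (f i)) (x : Stack n d) :
    avg (gradAvg f x) = gradient (globalCost f) (avg x) :=
  (gradient_globalCost hf (avg x)).symm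

/-- The decrease of the optimality gap at the average. -/
lemma gap_step_le (hn : 0 < n) {f : Fin n → EuclideanSpace ℝ (Fin d) → ℝ} {ℓ ν α : ℝ}
    (hf : ∀ i, IsSmoothWith ℓ (f i)) (hPL : PLCondition ν f) (hα : 0 < α) (x : Stack n d) :
    n * (globalCost f (avg x - α • avg (gradStack f x)) - optValue f) ≤
      n * (globalCost f (avg x) - optValue f) - α * ν * (n * (globalCost f (avg x) - optValue f))
      - α / 2 * ‖constStack n (avg (gradStack f x))‖ ^ 2
      + α / 2 * ‖constStack n (avg (gradStack f x - gradAvg f x))‖ ^ 2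
      + α ^ 2 * (ℓ / 2) * ‖constStack n (avg (gradStack f x))‖ ^ 2 := by
  have hn' : (0 : ℝ) ≤ n := n.cast_nonneg
  have h1 := (isSmoothWith_globalCost hn hf).le_quadratic (avg x) (-(α • avg (gradStack f x)))
  have h2 := hPL (avg x)
  rw [← sub_eq_add_neg, norm_neg, norm_smul, inner_neg_right, real_inner_smul_right, mul_pow,
    Real.norm_eq_abs, sq_abs] at h1
  -- Expanding the squared difference writes the inner product of the true and the averaged gradient
  -- through three squares; the Polyak–Łojasiewicz condition then bounds the square of the true
  -- gradient.
  rw [avg_sub, avg_gradAvg hf, norm_constStack_sq, norm_constStack_sq, norm_sub_sq_real,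
    real_inner_comm]
  have h3 := mul_le_mul_of_nonneg_left h1 hn'
  have h4 := mul_le_mul_of_nonneg_left h2 (mul_nonneg hα.le hn')
  linarith

/-- The Lyapunov function together with the compression error before the next compression
contracts along one step. -/
lemma lyapunov_step_le (hn : 2 ≤ n) {A : Matrix (Fin n) (Fin n) ℝ}
    (hA : IsUndirectedConnected A) {f : Fin n → EuclideanSpace ℝ (Fin d) → ℝ}
    {ℓ ν α β γ τ ω r δ : ℝ} (hf : ∀ i, IsSmoothWith ℓ (f i))
    (hbdd : BddBelow (Set.range (globalCost f))) (hν : 0 < ν) (hPL : PLCondition ν f)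
    (hP : Admissible (rho (laplacian A)) (rho2 (laplacian A)) ℓ α β γ τ ω r δ)
    {x v e x' v' : Stack n d} (hv : avg v = 0)
    (hx' : x' = x - α • (β • act (laplacian A) (x - e) + γ • v + gradStack f x))
    (hv' : v' = v + (α * γ) • act (laplacian A) (x - e)) :
    lyapunov f (act (pinv hA)) τ γ x' v' + (1 - 2 * eps9 ω r δ) * ‖x' - (x - e)‖ ^ 2 ≤
      (1 - α * eps6' (rho (laplacian A)) (rho2 (laplacian A)) ℓ ν α β γ τ ω r δ) *
        (lyapunov f (act (pinv hA)) τ γ x v + ‖e‖ ^ 2) := by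
  have hn0 : 0 < n := by omega
  have hT := isPseudoInverse_laplacian d hn hA
  obtain ⟨L, hLdef⟩ : ∃ L : Stack n d →ₗ[ℝ] Stack n d, L = act (laplacian A) := ⟨_, rfl⟩
  obtain ⟨K, hKdef⟩ : ∃ K : Stack n d →ₗ[ℝ] Stack n d, K = act (centering n) := ⟨_, rfl⟩
  obtain ⟨Q, hQdef⟩ : ∃ Q : Stack n d →ₗ[ℝ] Stack n d, Q = act (pinv hA) := ⟨_, rfl⟩
  have hKx : ∀ z, K z = z - constStack n (avg z) := fun z => by rw [hKdef, act_centering]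
  have hpyth : ∀ z, ‖z‖ ^ 2 = ‖K z‖ ^ 2 + ‖constStack n (avg z)‖ ^ 2 := fun z => by
    rw [hKdef]; exact norm_sq_eq_centering_add hn0 z
  have hKle : ∀ z, ‖K z‖ ≤ ‖z‖ := fun z => by rw [hKdef]; exact norm_centering_le hn0 z
  simp only [lyapunov]
  rw [← hLdef, ← hKdef, ← hQdef] at hT
  rw [← hLdef] at hx' hv'
  rw [← hKdef, ← hQdef]
  generalize rho (laplacian A) = ρ at *
  generalize rho2 (laplacian A) = ρ₂ at *
  have havgL : ∀ z, avg (L z) = 0 := fun z => by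
    have h1 := hT.K_L z
    rw [hKx, sub_eq_self] at h1
    rw [← avg_constStack hn0 (avg (L z)), h1, ← zero_smul ℝ (0 : Stack n d), avg_smul, zero_smul]
  have hKv : K v = v := by
    rw [hKx, hv, sub_eq_self]
    rfl
  obtain ⟨g, hg⟩ : ∃ g, g = gradStack f x := ⟨_, rfl⟩
  obtain ⟨X, hXdef⟩ : ∃ X, X = K x := ⟨_, rfl⟩
  obtain ⟨E, hEdef⟩ : ∃ E, E = K e := ⟨_, rfl⟩
  obtain ⟨W, hWdef⟩ : ∃ W, W = K (v + γ⁻¹ • gradAvg f x) := ⟨_, rfl⟩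
  obtain ⟨G, hGdef⟩ : ∃ G, G = K (g - gradAvg f x) := ⟨_, rfl⟩
  obtain ⟨D, hDdef⟩ : ∃ D, D = K (gradAvg f x' - gradAvg f x) := ⟨_, rfl⟩
  obtain ⟨Y, hYdef⟩ : ∃ Y, Y = β • L (X - E) + γ • W + G := ⟨_, rfl⟩
  have hγ := hP.gamma_pos
  have hα := hP.alpha_pos
  have hLS : L (X - E) = L (x - e) := by
    rw [hXdef, hEdef, ← map_sub, hT.L_K]
  -- The shift of `W` by the gradients at the average is compensated by their subtraction in `G`, so
  -- `Y` is exactly the centered update direction.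
  have hYK : Y = K (β • L (x - e) + γ • v + g) := by
    rw [hYdef, hLS, hWdef, hGdef]
    simp only [map_add, map_sub, map_smul, hT.K_L, smul_add, smul_smul]
    rw [mul_inv_cancel₀ hγ.ne', one_smul]
    abel
  have havg : avg (β • L (x - e) + γ • v + g) = avg g := by
    rw [avg_add, avg_add, avg_smul, avg_smul, havgL, hv]
    simp
  rw [← hg] at hx'
  have hKx' : K x' = X - α • Y := by
    rw [hx', hYK, map_sub, map_smul, hXdef]
  have hW' : K (v' + γ⁻¹ • gradAvg f x') = W + (α * γ) • L (X - E) + γ⁻¹ • D := by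
    rw [hv', hLS, hWdef, hDdef]
    simp only [map_add, map_sub, map_smul, hT.K_L, smul_sub]
    abel
  have havg' : avg x' = avg x - α • avg g := by
    rw [hx', avg_sub, avg_smul, havg]
  have hdiff : ‖x' - x‖ ^ 2 = α ^ 2 * (‖Y‖ ^ 2 + ‖constStack n (avg g)‖ ^ 2) := by
    rw [hx', sub_sub_cancel_left, norm_neg, norm_smul, mul_pow, Real.norm_eq_abs, sq_abs,
      hpyth (β • L (x - e) + γ • v + g), ← hYK, havg]
  -- By orthogonality one Lipschitz estimate controls the centered and the averaged gradient error
  -- together.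
  have hGle : ‖G‖ ^ 2 + ‖constStack n (avg (g - gradAvg f x))‖ ^ 2 ≤ ℓ ^ 2 * ‖X‖ ^ 2 := by
    rw [hGdef, ← hpyth, hXdef, hKx x, hg]
    exact norm_gradStack_sub_sq_le hf x _
  have hDle : ‖D‖ ≤ α * (ℓ * ‖constStack n (avg g)‖) := by
    have hℓ := hP.ell_pos
    rw [hDdef]
    refine (hKle _).trans (abs_le_of_sq_le_sq' ?_ (by positivity) |>.2)
    refine (norm_gradStack_sub_sq_le hf _ _).trans (le_of_eq ?_)
    have : constStack n (avg x') - constStack n (avg x) = (-α) • constStack n (avg g) := by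
      rw [havg']
      ext1 i
      simp [constStack]
    rw [this, norm_smul, Real.norm_eq_abs, abs_neg, abs_of_pos hα]
    ring
  have hstep := lyap_step_le hT hP.rho2_pos hP.rho2_le hα hP.tau_ge hP.beta_eq hγ hP.ell_pos
    hP.gamma_ge hP.eps10_nonneg (by rw [hXdef, hT.K_K]) (by rw [hEdef, hT.K_K])
    (by rw [hWdef, hT.K_K]) hGle hDle hYdef
  have hgap := gap_step_le hn0 hf hPL hα x
  rw [← hg] at hgap
  -- Young's inequality with weight `ε₉`: the products `(1 - 2ε₉)(1 + ε₉)` and `(1 - 2ε₉)(1 + ε₉⁻¹)`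
  -- are `1 - 2ε₁₂` and `ε₁₀`.
  have hcomp : (1 - 2 * eps9 ω r δ) * ‖x' - (x - e)‖ ^ 2 ≤
      (1 - 2 * eps12 ω r δ) * ‖e‖ ^ 2 + eps10 ω r δ * ‖x' - x‖ ^ 2 := by
    have h9 := hP.eps9_pos
    have h1 : ‖x' - (x - e)‖ ≤ ‖e‖ + ‖x' - x‖ := by
      rw [show x' - (x - e) = e + (x' - x) by abel]
      exact norm_add_le _ _
    have h2 : ‖x' - (x - e)‖ ^ 2 ≤
        (1 + eps9 ω r δ) * ‖e‖ ^ 2 + (1 + (eps9 ω r δ)⁻¹) * ‖x' - x‖ ^ 2 := by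
      refine (pow_le_pow_left₀ (norm_nonneg _) h1 2).trans ?_
      have h3 : (1 + eps9 ω r δ) * ‖e‖ ^ 2 + (1 + (eps9 ω r δ)⁻¹) * ‖x' - x‖ ^ 2
          - (‖e‖ + ‖x' - x‖) ^ 2 =
          (eps9 ω r δ)⁻¹ * (eps9 ω r δ * ‖e‖ - ‖x' - x‖) ^ 2 := by
        field_simp; ring
      have h4 : 0 ≤ (eps9 ω r δ)⁻¹ * (eps9 ω r δ * ‖e‖ - ‖x' - x‖) ^ 2 := by positivity
      linarith
    have h5 := mul_le_mul_of_nonneg_left h2 (by linarith [hP.eps9_le] : 0 ≤ 1 - 2 * eps9 ω r δ)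
    refine h5.trans (le_of_eq ?_)
    rw [eps12, eps10]
    ring
  have hlyap := lyap_le hT hP.rho2_pos hP.tau_ge X W
  have hgap0 : 0 ≤ n * (globalCost f (avg x) - optValue f) :=
    mul_nonneg n.cast_nonneg (sub_nonneg.mpr (ciInf_le hbdd _))
  have hEle : ‖E‖ ^ 2 ≤ ‖e‖ ^ 2 := by
    rw [hEdef]
    exact pow_le_pow_left₀ (norm_nonneg _) (hKle e) 2
  have hWQ : 0 ≤ inner ℝ W (Q W) :=
    le_trans (mul_nonneg hP.rho2_pos.le (sq_nonneg _)) (hT.norm_Q_le W)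
  obtain ⟨m1, m2, m3, m4⟩ := hP.eps6_mul_eps2 ν
  have h6 := hP.eps6_pos hν
  rw [hKx', hW', havg', ← hXdef, ← hWdef]
  rw [hdiff] at hcomp
  have h56 := hP.phi56
  have h10 := hP.alpha_eps10_le
  have he2 := hP.one_le_eps2
  generalize eps6' ρ ρ₂ ℓ ν α β γ τ ω r δ = κ at *
  have t1 := mul_le_mul_of_nonneg_left hEle hP.phi78_nonneg
  have t2 := mul_le_mul_of_nonneg_left
    (mul_le_mul_of_nonneg_right m2 (sq_nonneg ‖X‖)) hα.le
  have t3 := mul_le_mul_of_nonneg_left (mul_le_mul_of_nonneg_right m3 hWQ) hα.le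
  have t4 := mul_le_mul_of_nonneg_right m4 (sq_nonneg ‖e‖)
  have hκ : κ ≤ κ * eps2 ρ₂ τ := le_mul_of_one_le_right h6.le he2
  have t5 := mul_le_mul_of_nonneg_left
    (mul_le_mul_of_nonneg_right hκ (sq_nonneg ‖e‖)) hα.le
  have t6 := mul_le_mul_of_nonneg_left
    (mul_le_mul_of_nonneg_right (show κ ≤ ν by linarith) hgap0) hα.le
  have t7 := mul_le_mul_of_nonneg_left hlyap (mul_nonneg hα.le h6.le)
  -- The total coefficient of the averaged gradient: `-1/2` from descent and `1/8` from the
  -- consensus part leave the `3/8` that must absorb `α ε₁₀`.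
  have t8 : 0 ≤ α * (phi5 ρ₂ ℓ β γ - α * phi6 ρ₂ ℓ β γ + 3 / 8 - α * eps10 ω r δ) *
      ‖constStack n (avg g)‖ ^ 2 :=
    mul_nonneg (mul_nonneg hα.le (by linarith)) (sq_nonneg _)
  linarith

end Descent


/-! ### The iterates along one noise realization -/

namespace State

variable {n d : ℕ}

/-- The stacked vector of the `x_i`. -/
def xs (S : State n d) : Stack n d := WithLp.toLp 2 S.x

/-- The stacked vector of the `v_i`. -/
def vs (S : State n d) : Stack n d := WithLp.toLp 2 S.v

/-- The stacked vector of the surrogates. -/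
def hs (S : State n d) : Stack n d := WithLp.toLp 2 S.xhat

/-- The invariants of the algorithm: `y = L x̂` and the `v_i` have mean zero. -/
def Invariant (L : Matrix (Fin n) (Fin n) ℝ) (S : State n d) : Prop :=
  (∀ i, S.y i = ∑ j, L i j • S.xhat j) ∧ avg S.vs = 0

end State

section Pathwise

variable {n d : ℕ}

lemma avg_act_laplacian {A : Matrix (Fin n) (Fin n) ℝ} (hA : IsUndirectedConnected A)
    (x : Stack n d) : avg (act (laplacian A) x) = 0 := by
  have hcol : ∀ j, ∑ i, laplacian A i j = 0 := fun j => by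
    have h := congrFun (laplacian_mulVec_const (A := A) 1) j
    simp only [Matrix.mulVec, dotProduct, mul_one, Pi.zero_apply] at h
    rw [← h]
    refine Finset.sum_congr rfl fun i _ => ?_
    exact congrFun (congrFun (laplacian_isHermitian hA) j) i
  simp only [avg, average, act]
  change (1 / (n : ℝ)) • ∑ i, ∑ j, laplacian A i j • x j = 0
  rw [Finset.sum_comm]
  simp only [← Finset.sum_smul, hcol, zero_smul, Finset.sum_const_zero, smul_zero]

variable {f : Fin n → EuclideanSpace ℝ (Fin d) → ℝ} {α β γ ω s : ℝ}
  {c : Fin n → EuclideanSpace ℝ (Fin d) → EuclideanSpace ℝ (Fin d)} {S : State n d}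

lemma step_y_eq {L : Matrix (Fin n) (Fin n) ℝ} (hS : S.Invariant L) (i : Fin n) :
    (S.step f L α β γ ω s c).y i = ∑ j, L i j • (S.step f L α β γ ω s c).xhat j := by
  simp only [State.step, hS.1, smul_add, Finset.sum_add_distrib, Finset.smul_sum]
  congr 1
  exact Finset.sum_congr rfl fun j _ => smul_comm _ _ _

lemma step_vs_eq {L : Matrix (Fin n) (Fin n) ℝ} (hS : S.Invariant L) :
    (S.step f L α β γ ω s c).vs =
      S.vs + (α * γ) • act L (S.step f L α β γ ω s c).hs := by
  ext1 i
  change S.v i + (α * γ) • (S.step f L α β γ ω s c).y i = _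
  rw [step_y_eq hS]
  rfl

lemma step_xs_eq {L : Matrix (Fin n) (Fin n) ℝ} (hS : S.Invariant L) :
    (S.step f L α β γ ω s c).xs = S.xs - α • (β • act L (S.step f L α β γ ω s c).hs
      + γ • S.vs + gradStack f S.xs) := by
  ext1 i
  change S.x i - α • (β • (S.step f L α β γ ω s c).y i + γ • S.v i + gradient (f i) (S.x i)) = _
  rw [step_y_eq hS]
  rfl

lemma invariant_step {A : Matrix (Fin n) (Fin n) ℝ} (hA : IsUndirectedConnected A)
    (hS : S.Invariant (laplacian A)) :
    (S.step f (laplacian A) α β γ ω s c).Invariant (laplacian A) := by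
  refine ⟨step_y_eq hS, ?_⟩
  rw [step_vs_eq hS, avg_add, avg_smul, avg_act_laplacian hA, hS.2, smul_zero, add_zero]

lemma invariant_run {Z : Type*} {A : Matrix (Fin n) (Fin n) ℝ} (hA : IsUndirectedConnected A)
    (s : ℕ → ℝ) (𝒞 : Z → EuclideanSpace ℝ (Fin d) → EuclideanSpace ℝ (Fin d))
    (x0 : Fin n → EuclideanSpace ℝ (Fin d)) (z : Fin n → ℕ → Z) (k : ℕ) :
    (run f (laplacian A) α β γ ω s 𝒞 x0 z k).Invariant (laplacian A) := by
  induction k with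
  | zero => exact ⟨fun i => by simp [run, State.init], by simp [run, State.init, State.vs, avg,
      average]⟩
  | succ k ih => exact invariant_step hA ih

lemma lyapunov_state_step_le (hn : 2 ≤ n) {A : Matrix (Fin n) (Fin n) ℝ}
    (hA : IsUndirectedConnected A) {ℓ ν τ r δ : ℝ} (hf : ∀ i, IsSmoothWith ℓ (f i))
    (hbdd : BddBelow (Set.range (globalCost f))) (hν : 0 < ν) (hPL : PLCondition ν f)
    (hP : Admissible (rho (laplacian A)) (rho2 (laplacian A)) ℓ α β γ τ ω r δ)
    (hS : S.Invariant (laplacian A)) {S' : State n d}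
    (hS' : S' = S.step f (laplacian A) α β γ ω s c) :
    lyapunov f (act (pinv hA)) τ γ S'.xs S'.vs
        + (1 - 2 * eps9 ω r δ) * ‖S'.xs - S'.hs‖ ^ 2 ≤
      (1 - α * eps6' (rho (laplacian A)) (rho2 (laplacian A)) ℓ ν α β γ τ ω r δ) *
        (lyapunov f (act (pinv hA)) τ γ S.xs S.vs + ‖S.xs - S'.hs‖ ^ 2) := by
  have h := lyapunov_step_le hn hA hf hbdd hν hPL hP (x := S.xs) (v := S.vs)
    (e := S.xs - S'.hs) (x' := S'.xs) (v' := S'.vs) hS.2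
  rw [sub_sub_cancel] at h
  rw [hS'] at h ⊢
  exact h (step_xs_eq hS) (step_vs_eq hS)

/-- The iterates up to iteration `k` depend only on the noise of the iterations before `k`. -/
lemma run_congr {Z : Type*} {L : Matrix (Fin n) (Fin n) ℝ} {s : ℕ → ℝ}
    {𝒞 : Z → EuclideanSpace ℝ (Fin d) → EuclideanSpace ℝ (Fin d)}
    {x0 : Fin n → EuclideanSpace ℝ (Fin d)} {z z' : Fin n → ℕ → Z} {k : ℕ}
    (h : ∀ i, ∀ t < k, z i t = z' i t) :
    run f L α β γ ω s 𝒞 x0 z k = run f L α β γ ω s 𝒞 x0 z' k := by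
  induction k with
  | zero => rfl
  | succ k ih =>
    rw [run, run, ih fun i t ht => h i t (ht.trans k.lt_succ_self)]
    congr 1
    funext i
    rw [h i k k.lt_succ_self]

end Pathwise

/-! ### Measurability -/

section Measurability

variable {n d : ℕ} {f : Fin n → EuclideanSpace ℝ (Fin d) → ℝ} {ℓ : ℝ}

/-- Joint measurability of the compressor is essential, as its argument is itself random; the
gradients are Lipschitz, hence Borel. -/
lemma measurable_run {Z : Type*} [MeasurableSpace Z] (hf : ∀ i, IsSmoothWith ℓ (f i))
    (L : Matrix (Fin n) (Fin n) ℝ) (α β γ ω : ℝ) (s : ℕ → ℝ)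
    {𝒞 : Z → EuclideanSpace ℝ (Fin d) → EuclideanSpace ℝ (Fin d)}
    (h𝒞 : Measurable fun p : Z × EuclideanSpace ℝ (Fin d) => 𝒞 p.1 p.2)
    (x0 : Fin n → EuclideanSpace ℝ (Fin d)) (k : ℕ) (i : Fin n) :
    Measurable (fun z => (run f L α β γ ω s 𝒞 x0 z k).x i) ∧
    Measurable (fun z => (run f L α β γ ω s 𝒞 x0 z k).v i) ∧
    Measurable (fun z => (run f L α β γ ω s 𝒞 x0 z k).xhat i) ∧
    Measurable (fun z => (run f L α β γ ω s 𝒞 x0 z k).y i) := by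
  induction k generalizing i with
  | zero => simp [run, State.init]
  | succ k ih =>
    have hz : ∀ j, Measurable fun z : Fin n → ℕ → Z => z j k := fun j => by fun_prop
    have hq : ∀ j, Measurable fun z : Fin n → ℕ → Z => 𝒞 (z j k) ((s k)⁻¹ •
        ((run f L α β γ ω s 𝒞 x0 z k).x j - (run f L α β γ ω s 𝒞 x0 z k).xhat j)) := fun j =>
      h𝒞.comp ((hz j).prodMk (((ih j).1.sub (ih j).2.2.1).fun_const_smul _))
    have hy : Measurable fun z => (run f L α β γ ω s 𝒞 x0 z (k + 1)).y i :=
      (ih i).2.2.2.add ((Finset.measurable_fun_sum _ fun j _ => (hq j).fun_const_smul _).fun_const_smul _)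
    refine ⟨?_, ?_, ?_, hy⟩
    · exact (ih i).1.sub (((hy.fun_const_smul β).add ((ih i).2.1.fun_const_smul γ)).add
        ((hf i).continuous_gradient.measurable.comp (ih i).1) |>.fun_const_smul α)
    · exact (ih i).2.1.add (hy.fun_const_smul _)
    · exact (ih i).2.2.1.add ((hq i).fun_const_smul _)

lemma continuous_avg : Continuous (avg : Stack n d → EuclideanSpace ℝ (Fin d)) := by
  unfold avg average
  fun_prop

lemma continuous_constStack :
    Continuous (constStack n : EuclideanSpace ℝ (Fin d) → Stack n d) := by
  unfold constStack
  fun_prop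

lemma continuous_gradStack (hf : ∀ i, IsSmoothWith ℓ (f i)) : Continuous (gradStack f) := by
  unfold gradStack
  refine (PiLp.continuous_toLp 2 _).comp (continuous_pi fun i => ?_)
  exact (hf i).continuous_gradient.comp (by fun_prop)

lemma continuous_globalCost (hf : ∀ i, IsSmoothWith ℓ (f i)) : Continuous (globalCost f) := by
  unfold globalCost
  exact (continuous_finsetSum _ fun i _ => (hf i).1.continuous).const_mul _

lemma continuous_act (M : Matrix (Fin n) (Fin n) ℝ) :
    Continuous fun x : Stack n d => act M x := by
  refine (PiLp.continuous_toLp 2 _).comp (continuous_pi fun i => ?_)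
  fun_prop

lemma continuous_lyapunov (hf : ∀ i, IsSmoothWith ℓ (f i)) (M : Matrix (Fin n) (Fin n) ℝ)
    (τ γ : ℝ) : Continuous fun p : Stack n d × Stack n d => lyapunov f (act M) τ γ p.1 p.2 := by
  have hQ := continuous_act (d := d) M
  have hK := continuous_act (d := d) (centering n)
  have hX : Continuous fun p : Stack n d × Stack n d => act (centering n) p.1 :=
    hK.comp continuous_fst
  have hW : Continuous fun p : Stack n d × Stack n d =>
      act (centering n) (p.2 + γ⁻¹ • gradAvg f p.1) := by
    refine hK.comp (continuous_snd.add (Continuous.fun_const_smul ?_ _))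
    exact (continuous_gradStack hf).comp
      (continuous_constStack.comp (continuous_avg.comp continuous_fst))
  have hc : Continuous fun p : Stack n d × Stack n d => globalCost f (avg p.1) :=
    (continuous_globalCost hf).comp (continuous_avg.comp continuous_fst)
  unfold lyapunov lyap
  exact (((hX.norm.pow 2).const_mul _ |>.add ((hW.inner (hQ.comp hW)).const_mul _)).add
    (hX.inner (hQ.comp hW))).add ((hc.sub continuous_const).const_mul _)

end Measurability

/-! ### The compression error -/

/-- Independence makes the joint law a product, so the fresh noise can be integrated first with the
history frozen. This replaces conditional expectation. -/
lemma lintegral_le_of_indepFun {Ω Z T : Type*} [MeasurableSpace Ω] [MeasurableSpace Z]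
    [MeasurableSpace T] {μ : Measure Ω} [IsProbabilityMeasure μ] {P : Measure Z} [SFinite P]
    {ζ : Ω → Z} {H : Ω → T} (hζ : MeasurePreserving ζ μ P) (hH : Measurable H)
    (hind : IndepFun ζ H μ) {F : Z × T → ENNReal} (hF : Measurable F) {B : T → ENNReal}
    (hB : Measurable B) (hFB : ∀ t, ∫⁻ z, F (z, t) ∂P ≤ B t) :
    ∫⁻ a, F (ζ a, H a) ∂μ ≤ ∫⁻ a, B (H a) ∂μ := by
  have hmap := (indepFun_iff_map_prod_eq_prod_map_map hζ.measurable.aemeasurable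
    hH.aemeasurable).mp hind
  rw [hζ.map_eq] at hmap
  rw [← lintegral_map hF (hζ.measurable.prodMk hH), hmap, lintegral_prod_symm' _ hF,
    ← lintegral_map hB hH]
  exact lintegral_mono hFB

/-- The mean squared error after one use of the compressor with scaling factor `s`. -/
lemma lintegral_compression_le {d : ℕ} {Z : Type*} [MeasurableSpace Z] {P : Measure Z}
    [IsProbabilityMeasure P] {𝒞 : Z → EuclideanSpace ℝ (Fin d) → EuclideanSpace ℝ (Fin d)}
    {r δ C ω s : ℝ} (hr : 0 < r) (h𝒞 : GloballyBounded P 𝒞 r δ C)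
    (hω : ω ∈ Set.Ioc (0 : ℝ) (1 / r)) (hs : 0 < s) (u : EuclideanSpace ℝ (Fin d)) :
    ∫⁻ z, ENNReal.ofReal (‖u - (ω * s) • 𝒞 z (s⁻¹ • u)‖ ^ 2) ∂P ≤
      ENNReal.ofReal ((1 - 2 * eps9 ω r δ) * ‖u‖ ^ 2 + ω * r * C * s ^ 2) := by
  have hωr : ω * r ≤ 1 := (le_div_iff₀ hr).mp hω.2
  have hωr0 : 0 < ω * r := mul_pos hω.1 hr
  have hpt : ∀ z, ‖u - (ω * s) • 𝒞 z (s⁻¹ • u)‖ ^ 2 ≤ (1 - ω * r) * ‖u‖ ^ 2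
      + ω * r * s ^ 2 * ‖r⁻¹ • 𝒞 z (s⁻¹ • u) - s⁻¹ • u‖ ^ 2 := fun z => by
    -- A convex combination with weight `ωr ≤ 1` of `u` and the rescaled error of one compression.
    -- Convexity of the squared norm then gives the factor `(1 - ωr) + ωr(1 - δ) = 1 - 2ε₉`.
    have hsplit : u - (ω * s) • 𝒞 z (s⁻¹ • u) =
        (1 - ω * r) • u + (ω * r) • (-(s • (r⁻¹ • 𝒞 z (s⁻¹ • u) - s⁻¹ • u))) := by
      rw [smul_sub, smul_smul, smul_smul, mul_inv_cancel₀ hs.ne', one_smul, neg_sub, smul_sub,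
        smul_smul, show ω * r * (s * r⁻¹) = ω * s by field_simp, sub_smul, one_smul]
      abel
    have hconv := (convexOn_univ_norm (E := EuclideanSpace ℝ (Fin d))).pow
      (fun _ _ => norm_nonneg _) 2
    have h := hconv.2 (Set.mem_univ u)
      (Set.mem_univ (-(s • (r⁻¹ • 𝒞 z (s⁻¹ • u) - s⁻¹ • u))))
      (sub_nonneg.mpr hωr) hωr0.le (sub_add_cancel _ _)
    rw [← hsplit] at h
    simp only [Pi.pow_apply, norm_neg, norm_smul, smul_eq_mul, mul_pow, Real.norm_eq_abs,
      sq_abs] at h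
    linarith
  have hint : Integrable (fun z => (1 - ω * r) * ‖u‖ ^ 2
      + ω * r * s ^ 2 * ‖r⁻¹ • 𝒞 z (s⁻¹ • u) - s⁻¹ • u‖ ^ 2) P :=
    (integrable_const _).add ((h𝒞.integrable (s⁻¹ • u)).const_mul _)
  refine (lintegral_mono fun z => ENNReal.ofReal_le_ofReal (hpt z)).trans ?_
  rw [← ofReal_integral_eq_lintegral_ofReal hint (ae_of_all _ fun z => by
    have : 0 ≤ 1 - ω * r := sub_nonneg.mpr hωr
    positivity)]
  refine ENNReal.ofReal_le_ofReal ?_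
  rw [integral_add (integrable_const _) ((h𝒞.integrable (s⁻¹ • u)).const_mul _), integral_const,
    integral_const_mul, probReal_univ, one_smul]
  have h1 := mul_le_mul_of_nonneg_left (h𝒞.bound (s⁻¹ • u))
    (by positivity : 0 ≤ ω * r * s ^ 2)
  refine (add_le_add_right h1 _).trans (le_of_eq ?_)
  rw [norm_smul, mul_pow, Real.norm_eq_abs, sq_abs, eps9]
  field_simp
  ring


lemma measurable_noise {n : ℕ} {Ω Z : Type*} [MeasurableSpace Ω] [MeasurableSpace Z]
    {μ : Measure Ω} {P : Measure Z} {ζ : Fin n → ℕ → Ω → Z} (hζ : IsCompressionNoise μ P ζ) :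
    Measurable fun (a : Ω) (i : Fin n) (t : ℕ) => ζ i t a :=
  measurable_pi_lambda _ fun i => measurable_pi_lambda _ fun t => (hζ.law i t).measurable

lemma measurable_lyapunov_run {n d : ℕ} {f : Fin n → EuclideanSpace ℝ (Fin d) → ℝ} {ℓ : ℝ}
    {Ω Z : Type*} [MeasurableSpace Ω] [MeasurableSpace Z] (hf : ∀ i, IsSmoothWith ℓ (f i))
    (L : Matrix (Fin n) (Fin n) ℝ) (α β γ ω : ℝ) (s : ℕ → ℝ)
    {𝒞 : Z → EuclideanSpace ℝ (Fin d) → EuclideanSpace ℝ (Fin d)}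
    (h𝒞 : Measurable fun p : Z × EuclideanSpace ℝ (Fin d) => 𝒞 p.1 p.2)
    (x0 : Fin n → EuclideanSpace ℝ (Fin d))
    {μ : Measure Ω} {P : Measure Z} {ζ : Fin n → ℕ → Ω → Z} (hζ : IsCompressionNoise μ P ζ)
    (M : Matrix (Fin n) (Fin n) ℝ) (τ : ℝ) (k : ℕ) :
    Measurable fun a => lyapunov f (act M) τ γ
      (run f L α β γ ω s 𝒞 x0 (fun i t => ζ i t a) k).xs
      (run f L α β γ ω s 𝒞 x0 (fun i t => ζ i t a) k).vs := by
  have hm := measurable_run hf L α β γ ω s h𝒞 x0 k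
  have hxs : Measurable fun z => (run f L α β γ ω s 𝒞 x0 z k).xs :=
    (WithLp.measurable_toLp 2 (Fin n → EuclideanSpace ℝ (Fin d))).comp
      (measurable_pi_lambda _ fun i => (hm i).1)
  have hvs : Measurable fun z => (run f L α β γ ω s 𝒞 x0 z k).vs :=
    (WithLp.measurable_toLp 2 (Fin n → EuclideanSpace ℝ (Fin d))).comp
      (measurable_pi_lambda _ fun i => (hm i).2.1)
  have h1 : Measurable fun p : Stack n d × Stack n d => lyapunov f (act M) τ γ p.1 p.2 :=
    (continuous_lyapunov hf M τ γ).measurable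
  exact (h1.comp (hxs.prodMk hvs)).comp (measurable_noise hζ)

/-! ### Averaging the compression error over the fresh noise -/

section Expectation

variable {n d : ℕ} {f : Fin n → EuclideanSpace ℝ (Fin d) → ℝ} {ℓ : ℝ}
  {Z : Type*} [MeasurableSpace Z] {P : Measure Z} [IsProbabilityMeasure P]
  {𝒞 : Z → EuclideanSpace ℝ (Fin d) → EuclideanSpace ℝ (Fin d)} {r δ C : ℝ}
  {Ω : Type*} [MeasurableSpace Ω] {μ : Measure Ω} [IsProbabilityMeasure μ]
  {ζ : Fin n → ℕ → Ω → Z}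

/-- The noise realization with the given history, continued by a constant. -/
def extendHistory (z₀ : Z) {k : ℕ} (h : Fin n → Fin k → Z) : Fin n → ℕ → Z :=
  fun j t => if ht : t < k then h j ⟨t, ht⟩ else z₀

lemma measurable_extendHistory (z₀ : Z) (k : ℕ) :
    Measurable (extendHistory z₀ : (Fin n → Fin k → Z) → Fin n → ℕ → Z) := by
  refine measurable_pi_lambda _ fun j => measurable_pi_lambda _ fun t => ?_
  by_cases ht : t < k
  · simp only [extendHistory, ht, dite_true]
    fun_prop
  · simp only [extendHistory, ht, dite_false]
    exact measurable_const

variable (L : Matrix (Fin n) (Fin n) ℝ) (α β γ : ℝ) {ω : ℝ}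
  (s : ℕ → ℝ) (x0 : Fin n → EuclideanSpace ℝ (Fin d))

/-- The state at iteration `k` is a function of the finite history alone; `extendHistory` fills the
irrelevant future with an arbitrary `z₀`, so independence from the history applies. -/
lemma lintegral_agent_error_le (hf : ∀ i, IsSmoothWith ℓ (f i)) (hr : 0 < r)
    (h𝒞 : GloballyBounded P 𝒞 r δ C)
    (hζ : IsCompressionNoise μ P ζ) (hω : ω ∈ Set.Ioc (0 : ℝ) (1 / r)) (hs : ∀ k, 0 < s k)
    (k : ℕ) (i : Fin n) :
    ∫⁻ a, ENNReal.ofReal (‖(run f L α β γ ω s 𝒞 x0 (fun i t => ζ i t a) k).x i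
      - (run f L α β γ ω s 𝒞 x0 (fun i t => ζ i t a) (k + 1)).xhat i‖ ^ 2) ∂μ ≤
    ∫⁻ a, ENNReal.ofReal ((1 - 2 * eps9 ω r δ) *
      ‖(run f L α β γ ω s 𝒞 x0 (fun i t => ζ i t a) k).x i
        - (run f L α β γ ω s 𝒞 x0 (fun i t => ζ i t a) k).xhat i‖ ^ 2
      + ω * r * C * s k ^ 2) ∂μ := by
  obtain ⟨z₀⟩ : Nonempty Z := nonempty_of_isProbabilityMeasure P
  let H : Ω → Fin n → Fin k → Z := fun a j t => ζ j t a
  have hH : Measurable H :=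
    measurable_pi_lambda _ fun j => measurable_pi_lambda _ fun t => (hζ.law j t).measurable
  let u : (Fin n → Fin k → Z) → EuclideanSpace ℝ (Fin d) := fun h =>
    (run f L α β γ ω s 𝒞 x0 (extendHistory z₀ h) k).x i
      - (run f L α β γ ω s 𝒞 x0 (extendHistory z₀ h) k).xhat i
  have hu : Measurable u := by
    have h := measurable_run hf L α β γ ω s h𝒞.measurable x0 k i
    exact (h.1.sub h.2.2.1).comp (measurable_extendHistory z₀ k)
  have hrun : ∀ a, run f L α β γ ω s 𝒞 x0 (extendHistory z₀ (H a)) k =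
      run f L α β γ ω s 𝒞 x0 (fun i t => ζ i t a) k := fun a =>
    run_congr fun j t ht => by simp [extendHistory, H, ht]
  have hFm : Measurable fun p : Z × (Fin n → Fin k → Z) =>
      ENNReal.ofReal (‖u p.2 - (ω * s k) • 𝒞 p.1 ((s k)⁻¹ • u p.2)‖ ^ 2) := by
    have h2 : Measurable fun p : Z × (Fin n → Fin k → Z) => u p.2 := hu.comp measurable_snd
    have h1 : Measurable fun p : Z × (Fin n → Fin k → Z) => 𝒞 p.1 ((s k)⁻¹ • u p.2) :=
      h𝒞.measurable.comp (measurable_fst.prodMk (h2.fun_const_smul _))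
    exact ((h2.sub (h1.fun_const_smul _)).norm.pow_const 2).ennreal_ofReal
  have hBm : Measurable fun h => ENNReal.ofReal ((1 - 2 * eps9 ω r δ) * ‖u h‖ ^ 2
      + ω * r * C * s k ^ 2) :=
    (((hu.norm.pow_const 2).const_mul _).add_const _).ennreal_ofReal
  have key := lintegral_le_of_indepFun (hζ.law i k) hH (hζ.indep i k) hFm hBm
    fun h => lintegral_compression_le hr h𝒞 hω (hs k) (u h)
  have hstep : ∀ a, u (H a) - (ω * s k) • 𝒞 (ζ i k a) ((s k)⁻¹ • u (H a)) =
      (run f L α β γ ω s 𝒞 x0 (fun i t => ζ i t a) k).x i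
        - (run f L α β γ ω s 𝒞 x0 (fun i t => ζ i t a) (k + 1)).xhat i := fun a => by
    simp only [u, hrun a]
    rw [sub_sub]
    rfl
  simp only [hstep] at key
  simpa only [u, hrun] using key

/-- The squared norm is a sum over agents and integration is additive, so no joint law of the agents
within one iteration enters. -/
lemma lintegral_error_le (hf : ∀ i, IsSmoothWith ℓ (f i)) (hr : 0 < r)
    (hδ : δ ∈ Set.Ioc (0 : ℝ) 1) (hC : 0 < C)
    (h𝒞 : GloballyBounded P 𝒞 r δ C)
    (hζ : IsCompressionNoise μ P ζ) (hω : ω ∈ Set.Ioc (0 : ℝ) (1 / r)) (hs : ∀ k, 0 < s k)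
    (k : ℕ) :
    ∫⁻ a, ENNReal.ofReal (‖(run f L α β γ ω s 𝒞 x0 (fun i t => ζ i t a) k).xs
      - (run f L α β γ ω s 𝒞 x0 (fun i t => ζ i t a) (k + 1)).hs‖ ^ 2) ∂μ ≤
    ∫⁻ a, ENNReal.ofReal ((1 - 2 * eps9 ω r δ) *
      ‖(run f L α β γ ω s 𝒞 x0 (fun i t => ζ i t a) k).xs
        - (run f L α β γ ω s 𝒞 x0 (fun i t => ζ i t a) k).hs‖ ^ 2
      + n * (ω * r * C * s k ^ 2)) ∂μ := by
  have hm : ∀ k i, Measurable (fun a => (run f L α β γ ω s 𝒞 x0 (fun i t => ζ i t a) k).x i) ∧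
      Measurable (fun a => (run f L α β γ ω s 𝒞 x0 (fun i t => ζ i t a) k).xhat i) := fun k i => by
    have h := measurable_run hf L α β γ ω s h𝒞.measurable x0 k i
    exact ⟨h.1.comp (measurable_noise hζ), h.2.2.1.comp (measurable_noise hζ)⟩
  have h9 : 0 ≤ 1 - 2 * eps9 ω r δ := sub_nonneg.mpr (two_mul_eps9_le_one hr hδ hω)
  have hω0 := hω.1
  have hc : 0 ≤ ω * r * C * s k ^ 2 := by positivity
  have hleft : ∀ a, ENNReal.ofReal (‖(run f L α β γ ω s 𝒞 x0 (fun i t => ζ i t a) k).xs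
      - (run f L α β γ ω s 𝒞 x0 (fun i t => ζ i t a) (k + 1)).hs‖ ^ 2) =
      ∑ i, ENNReal.ofReal (‖(run f L α β γ ω s 𝒞 x0 (fun i t => ζ i t a) k).x i
      - (run f L α β γ ω s 𝒞 x0 (fun i t => ζ i t a) (k + 1)).xhat i‖ ^ 2) := fun a => by
    rw [norm_stack_sq, ENNReal.ofReal_sum_of_nonneg fun i _ => sq_nonneg _]
    rfl
  have hright : ∀ a, ENNReal.ofReal ((1 - 2 * eps9 ω r δ) *
      ‖(run f L α β γ ω s 𝒞 x0 (fun i t => ζ i t a) k).xs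
        - (run f L α β γ ω s 𝒞 x0 (fun i t => ζ i t a) k).hs‖ ^ 2
      + n * (ω * r * C * s k ^ 2)) =
      ∑ i, ENNReal.ofReal ((1 - 2 * eps9 ω r δ) *
      ‖(run f L α β γ ω s 𝒞 x0 (fun i t => ζ i t a) k).x i
        - (run f L α β γ ω s 𝒞 x0 (fun i t => ζ i t a) k).xhat i‖ ^ 2
      + ω * r * C * s k ^ 2) := fun a => by
    rw [← ENNReal.ofReal_sum_of_nonneg fun i _ => by positivity, norm_stack_sq,
      Finset.sum_add_distrib, Finset.mul_sum, Finset.sum_const, Finset.card_univ,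
      Fintype.card_fin, nsmul_eq_mul]
    rfl
  simp only [hleft, hright]
  rw [lintegral_finsetSum, lintegral_finsetSum]
  · exact Finset.sum_le_sum fun i _ =>
      lintegral_agent_error_le L α β γ s x0 hf hr h𝒞 hζ hω hs k i
  · exact fun i _ => (((((hm k i).1.sub (hm k i).2).norm.pow_const 2).const_mul
      _).add_const _).ennreal_ofReal
  · exact fun i _ => (((hm k i).1.sub (hm (k + 1) i).2).norm.pow_const 2).ennreal_ofReal

end Expectation

/-- The forcing decays at the same rate `q` as the homogeneous recursion; this resonance produces
the factor `k + 1`. -/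
lemma recursion_bound {V : ℕ → ENNReal} {q M B : ℝ} (hq : 0 ≤ q) (hM : 0 ≤ M) (hMB : M ≤ B)
    (h0 : V 0 ≤ ENNReal.ofReal B)
    (hV : ∀ k, V (k + 1) ≤ ENNReal.ofReal q * V k + ENNReal.ofReal (M * q ^ (k + 1))) (k : ℕ) :
    V k ≤ ENNReal.ofReal (B * ((k + 1) * q ^ k)) := by
  have hB : 0 ≤ B := hM.trans hMB
  induction k with
  | zero => simpa using h0
  | succ k ih =>
    refine (hV k).trans ((add_le_add_left (mul_le_mul_right ih _) _).trans ?_)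
    rw [← ENNReal.ofReal_mul hq, ← ENNReal.ofReal_add (by positivity) (by positivity)]
    refine ENNReal.ofReal_le_ofReal ?_
    have := mul_le_mul_of_nonneg_right hMB (pow_nonneg hq (k + 1))
    push_cast
    rw [pow_succ] at this ⊢
    linarith

/-! ### Comparison of the performance measure with the Lyapunov function -/

lemma performance_eq {n d : ℕ} (f : Fin n → EuclideanSpace ℝ (Fin d) → ℝ) (S : State n d) :
    performance f S.x = globalCost f (avg S.xs) - optValue f
      + (1 / (n : ℝ)) * ‖act (centering n) S.xs‖ ^ 2 := by
  rw [act_centering, norm_stack_sq]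
  rfl

lemma performance_nonneg {n d : ℕ} {f : Fin n → EuclideanSpace ℝ (Fin d) → ℝ}
    (hbdd : BddBelow (Set.range (globalCost f))) (x : Fin n → EuclideanSpace ℝ (Fin d)) :
    0 ≤ performance f x :=
  add_nonneg (sub_nonneg.mpr (ciInf_le hbdd _))
    (mul_nonneg (by positivity) (Finset.sum_nonneg fun _ _ => sq_nonneg _))

section Performance

variable {n d : ℕ} {A : Matrix (Fin n) (Fin n) ℝ} (hA : IsUndirectedConnected A)
  {f : Fin n → EuclideanSpace ℝ (Fin d) → ℝ} {τ : ℝ} (γ : ℝ)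

lemma le_lyapunov (hn : 2 ≤ n) (hτ : 4 / rho2 (laplacian A) ≤ τ) (x v : Stack n d) :
    1 / 4 * ‖act (centering n) x‖ ^ 2 + n * (globalCost f (avg x) - optValue f) ≤
      lyapunov f (act (pinv hA)) τ γ x v :=
  add_le_add_left (le_lyap (isPseudoInverse_laplacian d hn hA) (rho2_laplacian_pos hn hA) hτ _ _) _

lemma lyapunov_nonneg (hn : 2 ≤ n) (hbdd : BddBelow (Set.range (globalCost f)))
    (hτ : 4 / rho2 (laplacian A) ≤ τ) (x v : Stack n d) :
    0 ≤ lyapunov f (act (pinv hA)) τ γ x v := by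
  have h1 : 0 ≤ n * (globalCost f (avg x) - optValue f) :=
    mul_nonneg n.cast_nonneg (sub_nonneg.mpr (ciInf_le hbdd _))
  exact le_trans (by positivity) (le_lyapunov hA γ hn hτ x v)

lemma performance_le_lyapunov (hn : 2 ≤ n) (hbdd : BddBelow (Set.range (globalCost f)))
    (hτ : 4 / rho2 (laplacian A) ≤ τ) (S : State n d) :
    performance f S.x ≤ 4 / n * lyapunov f (act (pinv hA)) τ γ S.xs S.vs := by
  have hnR : (0 : ℝ) < n := by
    have : 0 < n := by omega
    exact_mod_cast this
  have h1 : 0 ≤ n * (globalCost f (avg S.xs) - optValue f) :=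
    mul_nonneg n.cast_nonneg (sub_nonneg.mpr (ciInf_le hbdd _))
  have h2 : (globalCost f (avg S.xs) - optValue f
      + 1 / (n : ℝ) * ‖act (centering n) S.xs‖ ^ 2) * n =
      n * (globalCost f (avg S.xs) - optValue f) + ‖act (centering n) S.xs‖ ^ 2 := by
    field_simp
  rw [performance_eq, div_mul_eq_mul_div (4 : ℝ), le_div_iff₀ hnR]
  linarith [le_lyapunov (f := f) hA γ hn hτ S.xs S.vs]

lemma continuous_performance {ℓ : ℝ} (hf : ∀ i, IsSmoothWith ℓ (f i)) :
    Continuous (performance f) := by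
  have havg : Continuous (average : (Fin n → EuclideanSpace ℝ (Fin d)) → _) := by
    unfold average
    fun_prop
  unfold performance
  refine (((continuous_globalCost hf).comp havg).sub continuous_const).add
    (Continuous.const_mul (continuous_finsetSum _ fun i _ => ?_) _)
  exact ((continuous_apply i).sub havg).norm.pow 2

end Performance

/-- The expected Lyapunov function, including the compression error, decays linearly up to a
factor linear in `k`. -/
lemma exists_lintegral_lyapunov_le {n d : ℕ} (hn : 2 ≤ n) {A : Matrix (Fin n) (Fin n) ℝ}
    (hA : IsUndirectedConnected A) {f : Fin n → EuclideanSpace ℝ (Fin d) → ℝ}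
    {ℓ ν : ℝ} (hf : ∀ i, IsSmoothWith ℓ (f i))
    (hbdd : BddBelow (Set.range (globalCost f))) (hν : 0 < ν) (hPL : PLCondition ν f)
    {Z : Type*} [MeasurableSpace Z] {P : Measure Z} [IsProbabilityMeasure P]
    {𝒞 : Z → EuclideanSpace ℝ (Fin d) → EuclideanSpace ℝ (Fin d)}
    {r δ C : ℝ} (hr : 0 < r) (hδ : δ ∈ Set.Ioc (0 : ℝ) 1) (hC : 0 < C)
    (h𝒞 : GloballyBounded P 𝒞 r δ C)
    {Ω : Type*} [MeasurableSpace Ω] {μ : Measure Ω} [IsProbabilityMeasure μ]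
    {ζ : Fin n → ℕ → Ω → Z} (hζ : IsCompressionNoise μ P ζ)
    (x0 : Fin n → EuclideanSpace ℝ (Fin d)) {α β γ τ ω ε s₀ q : ℝ}
    (hω : ω ∈ Set.Ioc (0 : ℝ) (1 / r)) (hε : 0 < ε) (hs₀ : 0 < s₀)
    (hP : Admissible (rho (laplacian A)) (rho2 (laplacian A)) ℓ α β γ τ ω r δ)
    (hq : 1 - α * eps6' (rho (laplacian A)) (rho2 (laplacian A)) ℓ ν α β γ τ ω r δ ≤ q)
    (hεq : ε ^ 2 ≤ q) :
    ∃ B, 0 ≤ B ∧ ∀ k, ∫⁻ a, ENNReal.ofReal (lyapunov f (act (pinv hA)) τ γ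
        (run f (laplacian A) α β γ ω (fun k => s₀ * ε ^ k) 𝒞 x0 (fun i t => ζ i t a) k).xs
        (run f (laplacian A) α β γ ω (fun k => s₀ * ε ^ k) 𝒞 x0 (fun i t => ζ i t a) k).vs) ∂μ
      ≤ ENNReal.ofReal (B * ((k + 1) * q ^ k)) := by
  have hq0 : 0 ≤ q := (sq_nonneg ε).trans hεq
  obtain ⟨s, hsdef⟩ : ∃ s : ℕ → ℝ, s = fun k => s₀ * ε ^ k := ⟨_, rfl⟩
  have hs : ∀ k, 0 < s k := fun k => by rw [hsdef]; positivity
  rw [← hsdef]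
  obtain ⟨R, hR⟩ : ∃ R : ℕ → Ω → State n d, R = fun k a =>
    run f (laplacian A) α β γ ω s 𝒞 x0 (fun i t => ζ i t a) k := ⟨_, rfl⟩
  have hRk : ∀ k a, run f (laplacian A) α β γ ω s 𝒞 x0 (fun i t => ζ i t a) k = R k a :=
    fun k a => by rw [hR]
  simp only [hRk]
  obtain ⟨U, hUdef⟩ : ∃ U : ℕ → Ω → ℝ, ∀ k a,
      U k a = lyapunov f (act (pinv hA)) τ γ (R k a).xs (R k a).vs := ⟨_, fun _ _ => rfl⟩
  obtain ⟨e, hedef⟩ : ∃ e : ℕ → Ω → ℝ, ∀ k a,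
      e k a = ‖(R k a).xs - (R (k + 1) a).hs‖ ^ 2 := ⟨_, fun _ _ => rfl⟩
  obtain ⟨b, hbdef⟩ : ∃ b : ℕ → Ω → ℝ, ∀ k a,
      b k a = (1 - 2 * eps9 ω r δ) * ‖(R k a).xs - (R k a).hs‖ ^ 2 := ⟨_, fun _ _ => rfl⟩
  simp only [← hUdef]
  have hUm : ∀ k, Measurable (U k) := fun k => by
    have h := measurable_lyapunov_run hf (laplacian A) α β γ ω s h𝒞.measurable x0 hζ
      (pinv hA) τ k
    simp only [hRk, ← hUdef] at h
    exact h
  have hb0 : ∀ k a, 0 ≤ b k a := fun k a => by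
    rw [hbdef]
    exact mul_nonneg (sub_nonneg.mpr hP.eps9_le) (sq_nonneg _)
  have he0 : ∀ k a, 0 ≤ e k a := fun k a => by rw [hedef]; exact sq_nonneg _
  have hU0 : ∀ k a, 0 ≤ U k a := fun k a => by
    rw [hUdef]
    exact lyapunov_nonneg hA γ hn hbdd hP.tau_ge _ _
  obtain ⟨M, hM⟩ : ∃ M : ℝ, M = n * (ω * r * C * s₀ ^ 2) := ⟨_, rfl⟩
  have hM0 : 0 ≤ M := by
    have := hω.1
    rw [hM]; positivity
  -- Compression turns the error `b k` before the draw into `e k` after it, at a cost proportional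
  -- to `s k ^ 2`, hence to `ε ^ (2 * k) ≤ q ^ k`.
  have herr : ∀ k, ∫⁻ a, ENNReal.ofReal (U k a + e k a) ∂μ ≤
      ∫⁻ a, ENNReal.ofReal (U k a + b k a) ∂μ + ENNReal.ofReal (M * q ^ k) := fun k => by
    have h1 : ∫⁻ a, ENNReal.ofReal (e k a) ∂μ ≤
        ∫⁻ a, ENNReal.ofReal (b k a + n * (ω * r * C * s k ^ 2)) ∂μ := by
      have h := lintegral_error_le (laplacian A) α β γ s x0 hf hr hδ hC h𝒞 hζ hω hs k
      simp only [hRk, ← hedef, ← hbdef] at h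
      exact h
    have h2 : (n : ℝ) * (ω * r * C * s k ^ 2) ≤ M * q ^ k := by
      have h3 : (n : ℝ) * (ω * r * C * s k ^ 2) = M * (ε ^ 2) ^ k := by
        rw [hM, hsdef]; ring
      rw [h3]
      exact mul_le_mul_of_nonneg_left (pow_le_pow_left₀ (sq_nonneg _) hεq k) hM0
    have hMk : 0 ≤ M * q ^ k := mul_nonneg hM0 (pow_nonneg hq0 k)
    calc ∫⁻ a, ENNReal.ofReal (U k a + e k a) ∂μ
        = ∫⁻ a, ENNReal.ofReal (U k a) ∂μ + ∫⁻ a, ENNReal.ofReal (e k a) ∂μ := by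
          rw [← lintegral_add_left (hUm k).ennreal_ofReal]
          exact lintegral_congr fun a => ENNReal.ofReal_add (hU0 k a) (he0 k a)
      _ ≤ ∫⁻ a, ENNReal.ofReal (U k a) ∂μ
          + ∫⁻ a, ENNReal.ofReal (b k a + M * q ^ k) ∂μ := by
          refine add_le_add le_rfl (h1.trans (lintegral_mono fun a => ?_))
          exact ENNReal.ofReal_le_ofReal (add_le_add le_rfl h2)
      _ = ∫⁻ a, (ENNReal.ofReal (U k a + b k a) + ENNReal.ofReal (M * q ^ k)) ∂μ := by
          rw [← lintegral_add_left (hUm k).ennreal_ofReal]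
          refine lintegral_congr fun a => ?_
          rw [ENNReal.ofReal_add (hb0 k a) hMk, ENNReal.ofReal_add (hU0 k a) (hb0 k a), add_assoc]
      _ = ∫⁻ a, ENNReal.ofReal (U k a + b k a) ∂μ + ENNReal.ofReal (M * q ^ k) := by
          rw [lintegral_add_right _ measurable_const, lintegral_const, measure_univ, mul_one]
  have hstep : ∀ k a, U (k + 1) a + b (k + 1) a ≤ q * (U k a + e k a) := fun k a => by
    have h := lyapunov_state_step_le hn hA hf hbdd hν hPL hP
      (invariant_run (f := f) (α := α) (β := β) (γ := γ) (ω := ω) hA s 𝒞 x0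
        (fun i t => ζ i t a) k) (S' := R (k + 1) a) (s := s k) (c := fun i => 𝒞 (ζ i k a))
        (by rw [hR]; rfl)
    rw [hRk, ← hUdef, ← hUdef, ← hbdef, ← hedef] at h
    exact h.trans (mul_le_mul_of_nonneg_right hq (add_nonneg (hU0 k a) (he0 k a)))
  -- The initial state is deterministic, so any sample point yields the starting constant.
  obtain ⟨a₀⟩ : Nonempty Ω := nonempty_of_isProbabilityMeasure μ
  have hMB : M ≤ U 0 a₀ + b 0 a₀ + M :=
    le_add_of_nonneg_left (add_nonneg (hU0 0 a₀) (hb0 0 a₀))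
  refine ⟨U 0 a₀ + b 0 a₀ + M, hM0.trans hMB, fun k => ?_⟩
  refine (lintegral_mono fun a => ENNReal.ofReal_le_ofReal
    (le_add_of_nonneg_right (he0 k a))).trans ?_
  refine recursion_bound (V := fun k => ∫⁻ a, ENNReal.ofReal (U k a + e k a) ∂μ) hq0 hM0 hMB
    ?_ (fun k => ?_) k
  · refine (herr 0).trans ?_
    have h1 : ∀ a, U 0 a + b 0 a = U 0 a₀ + b 0 a₀ := fun a => by
      simp only [hUdef, hbdef, hR, run]
    simp only [h1, lintegral_const, measure_univ, mul_one, pow_zero]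
    rw [← ENNReal.ofReal_add (add_nonneg (hU0 0 a₀) (hb0 0 a₀)) hM0]
  · refine (herr (k + 1)).trans ?_
    gcongr
    rw [← lintegral_const_mul' _ _ ENNReal.ofReal_ne_top]
    refine lintegral_mono fun a => ?_
    rw [← ENNReal.ofReal_mul hq0]
    exact ENNReal.ofReal_le_ofReal (hstep k a)

lemma isBigO_of_le_linear_mul_pow {u : ℕ → ℝ} {B q q' : ℝ} (hu : ∀ k, 0 ≤ u k) (hq : 0 ≤ q)
    (hqq' : q < q') (h : ∀ k, u k ≤ B * ((k + 1) * q ^ k)) :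
    u =O[atTop] fun k : ℕ => q' ^ k := by
  have hlt : ‖q‖ < q' := by rwa [Real.norm_of_nonneg hq]
  have hO : (fun k : ℕ => B * ((k + 1) * q ^ k)) =O[atTop] fun k : ℕ => q' ^ k := by
    have h1 := (isLittleO_pow_const_mul_const_pow_const_pow_of_norm_lt 1 hlt).isBigO
    have h0 := (isLittleO_pow_const_mul_const_pow_const_pow_of_norm_lt 0 hlt).isBigO
    refine ((h1.add h0).const_mul_left B).congr_left fun k => ?_
    ring
  refine (Asymptotics.IsBigO.of_bound 1 (Eventually.of_forall fun k => ?_)).trans hO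
  rw [one_mul, Real.norm_of_nonneg (hu k)]
  exact (h k).trans (Real.le_norm_self _)

end UnifiedCompression
end

theorem theorem5 {n d : ℕ} (hn : 2 ≤ n)
    -- communication network
    (A : Matrix (Fin n) (Fin n) ℝ) (hA : UnifiedCompression.IsUndirectedConnected A)
    (L : Matrix (Fin n) (Fin n) ℝ) (hL : L = UnifiedCompression.laplacian A)
    (ρ ρ₂ : ℝ) (hρ : ρ = UnifiedCompression.rho L) (hρ₂ : ρ₂ = UnifiedCompression.rho2 L)
    -- cost functions
    (f : Fin n → EuclideanSpace ℝ (Fin d) → ℝ)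
    (ℓ : ℝ) (hℓ : 0 < ℓ) (hsmooth : ∀ i, UnifiedCompression.IsSmoothWith ℓ (f i))
    (hbdd : BddBelow (Set.range (UnifiedCompression.globalCost f)))
    (ν : ℝ) (hν : 0 < ν) (hPL : UnifiedCompression.PLCondition ν f)
    -- compressor and its internal randomness
    {Z : Type*} [MeasurableSpace Z] (P : Measure Z) [IsProbabilityMeasure P]
    (𝒞 : Z → EuclideanSpace ℝ (Fin d) → EuclideanSpace ℝ (Fin d))
    (r δ C : ℝ) (hr : 0 < r) (hδ : δ ∈ Set.Ioc (0 : ℝ) 1) (hC : 0 < C)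
    (h𝒞 : UnifiedCompression.GloballyBounded P 𝒞 r δ C)
    {Ω : Type*} [MeasurableSpace Ω] (μ : Measure Ω) [IsProbabilityMeasure μ]
    (ζ : Fin n → ℕ → Ω → Z) (hζ : UnifiedCompression.IsCompressionNoise μ P ζ)
    -- parameters of the algorithm
    (x0 : Fin n → EuclideanSpace ℝ (Fin d))
    (α β γ τ₁ ω ε s₀ : ℝ)
    (hτ₁ : UnifiedCompression.kappa1 ρ₂ ≤ τ₁) (hβ : β = τ₁ * γ)
    (hγ : UnifiedCompression.kappa2 ρ₂ ℓ < γ) (hω : ω ∈ Set.Ioc (0 : ℝ) (1 / r))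
    (hα : α ∈ Set.Ioo (0 : ℝ) (UnifiedCompression.kappa0' ρ ρ₂ ℓ β γ ω r δ))
    (hε : ε ∈ Set.Ioo (0 : ℝ) 1)
    (p : ENNReal) [Fact (1 ≤ p)] (hs₀ : 0 < s₀) (hx0 : ∀ i, ‖WithLp.toLp p (x0 i).ofLp‖ ≤ s₀)
    -- the iterates
    (x : ℕ → Ω → Fin n → EuclideanSpace ℝ (Fin d))
    (hx : ∀ k a, x k a = (UnifiedCompression.run f L α β γ ω (fun k => s₀ * ε ^ k) 𝒞 x0
      (fun i t => ζ i t a) k).x)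
    -- the lower end of the range of rates
    (ε₀ : ℝ) (hε₀ : ε₀ = max
      (1 - α * UnifiedCompression.eps6' ρ ρ₂ ℓ ν α β γ τ₁ ω r δ) (ε ^ 2)) :
    ε₀ ∈ Set.Ioo (0 : ℝ) 1 ∧
    (∀ k, Integrable (fun a => UnifiedCompression.performance f (x k a)) μ) ∧
    ∀ ε' ∈ Set.Ioo ε₀ 1,
      (fun k : ℕ => ∫ a, UnifiedCompression.performance f (x k a) ∂μ)
        =O[atTop] (fun k : ℕ => ε' ^ k) := by
  subst hL hρ hρ₂
  have hρ₂pos := UnifiedCompression.rho2_laplacian_pos hn hA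
  have hP := UnifiedCompression.admissible hρ₂pos
    (UnifiedCompression.rho2_le_rho_laplacian hn hA) hℓ hr hδ hω hτ₁ hβ hγ hα
  have hε₀mem : ε₀ ∈ Set.Ioo (0 : ℝ) 1 := by
    rw [hε₀]
    -- Positivity comes from `ε²`, so no lower bound on `1 - αε₆'` is needed.
    refine ⟨lt_max_of_lt_right (pow_pos hε.1 2), max_lt ?_ ?_⟩
    · linarith [mul_pos hP.alpha_pos (hP.eps6_pos hν)]
    · exact pow_lt_one₀ hε.1.le hε.2 two_ne_zero
  obtain ⟨B, hB, hbound⟩ := UnifiedCompression.exists_lintegral_lyapunov_le hn hA hsmooth hbdd hν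
    hPL hr hδ hC h𝒞 hζ x0 (q := ε₀) hω hε.1 hs₀ hP (hε₀ ▸ le_max_left _ _)
    (hε₀ ▸ le_max_right _ _)
  have hperf0 : ∀ k a, 0 ≤ UnifiedCompression.performance f (x k a) := fun k a =>
    UnifiedCompression.performance_nonneg hbdd _
  have hperfm : ∀ k, Measurable fun a => UnifiedCompression.performance f (x k a) := fun k => by
    simp only [hx]
    refine (UnifiedCompression.continuous_performance hsmooth).measurable.comp
      (measurable_pi_lambda _ fun i => ?_)
    exact (UnifiedCompression.measurable_run hsmooth _ α β γ ω _ h𝒞.measurable x0 k i).1.comp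
      (UnifiedCompression.measurable_noise hζ)
  have hlint : ∀ k, ∫⁻ a, ENNReal.ofReal (UnifiedCompression.performance f (x k a)) ∂μ ≤
      ENNReal.ofReal (4 / n * B * ((k + 1) * ε₀ ^ k)) := fun k => by
    have h4 : (0 : ℝ) ≤ 4 / n := by positivity
    rw [mul_assoc, ENNReal.ofReal_mul h4]
    refine le_trans ?_ (mul_le_mul_right (hbound k) _)
    rw [← lintegral_const_mul' _ _ ENNReal.ofReal_ne_top]
    refine lintegral_mono fun a => ?_
    rw [← ENNReal.ofReal_mul h4, hx]
    exact ENNReal.ofReal_le_ofReal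
      (UnifiedCompression.performance_le_lyapunov hA γ hn hbdd hP.tau_ge _)
  refine ⟨hε₀mem, fun k => ⟨(hperfm k).aestronglyMeasurable, ?_⟩, fun ε' hε' => ?_⟩
  · rw [hasFiniteIntegral_iff_ofReal (ae_of_all _ (hperf0 k))]
    exact (hlint k).trans_lt ENNReal.ofReal_lt_top
  · refine UnifiedCompression.isBigO_of_le_linear_mul_pow (B := 4 / n * B)
      (fun k => integral_nonneg (hperf0 k)) hε₀mem.1.le hε'.1 fun k => ?_
    have := hε₀mem.1
    rw [integral_eq_lintegral_of_nonneg_ae (ae_of_all _ (hperf0 k))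
      (hperfm k).aestronglyMeasurable]
    exact ENNReal.toReal_le_of_le_ofReal (by positivity) (hlint k)
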